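/- **Conventions.** A partition $\alpha=(\alpha_1\ge\alpha_2\ge\cdots)$ is drawn as a Young diagram with top-aligned columns of lengths $\alpha_1,\alpha_2,\dots$; rows are numbered from the top, $\overline{\alpha}$ is the transposed partition (so $\overline\alpha_i$ is the length of row $i$) and $|\alpha|$ is the weight. For partitions $\mu,\nu$ (of possibly different weights) write $\mu\le_{\rm nat}\nu$ if $\sum_{i\le c}\overline{\mu}_i\le\sum_{i\le c}\overline{\nu}_i$ for all $c$. For $\gamma\subseteq\beta$, the skew diagram $\beta\setminus\gamma$ is a *rook strip* if $\beta_i\le\gamma_i+1$ and $\overline\beta_i\le\overline\gamma_i+1$ for all $i$. **Tableaux.** An *LR-tableau* of shape $\beta\setminus\gamma$ and content $\alpha$ is a filling of $\beta\setminus\gamma$ with $\overline\alpha_1$ entries $1$, $\overline\alpha_2$ entries $2$, etc., weakly increasing along rows, strictly increasing down columns, and such that for all $j$ and $e\ge1$ the columns with number $\ge j$ contain at least as many entries $e$ as entries $e+1$. Let $\mathcal T_{r,\gamma}^\beta$ be the set of LR-tableaux of shape $\beta\setminus\gamma$ whose content $\alpha$ satisfies $|\alpha|=r$. For $\Gamma\in\mathcal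 T_{r,\gamma}^\beta$ let $\gamma^{(e)}$ be the partition whose diagram consists of $\gamma$ and the boxes of $\beta\setminus\gamma$ with entry at most $e$; write $\Gamma=[\gamma^{(0)},\gamma^{(1)},\dots]$. **Combinatorial orders** on $\mathcal T_{r,\gamma}^\beta$. The *box order* $\le_{\rm box}$ is the reflexive and transitive closure of the relation $\prec_{\rm box}$, where $\Delta\prec_{\rm box}\Gamma$ if $\Delta$ is obtained from $\Gamma$ by swapping two different entries so that the smaller one winds up in the lower row, or by increasing one entry. The *dominance order* is given by $\Delta\le_{\rm dom}\Gamma$ if $\delta^{(i)}\le_{\rm nat}\gamma^{(i)}$ for $0\le i\le r$. **Algebraic orders.** Let $k$ be a field and $\Lambda=k[p]$. Let $\mathcal S$ be the category of embeddings $(A\subseteq B)$, where $B$ is a finite dimensional $\Lambda$-module on which $p$ acts nilpotently and $A$ is a submodule; morphisms $(A\subseteq B)\to(A'\subseteq B')$ are the $\Lambda$-linear maps $f:B\to B'$ with $f(A)\subseteq A'$, and a sequence $0\to U\to H\to V\to0$ in $\mathcal S$ is exact if it is exact on both the submodules and the ambient modules. Put $N_\alpha=\bigoplus_i\Lambda/(p^{\alpha_i})$,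 and let $\mathcal S_{r,\gamma}^\beta$ consist of the embeddings $(A\subseteq B)$ with $B\cong N_\beta$, $B/A\cong N_\gamma$ and $A\cong N_\alpha$ for some $\alpha$ with $|\alpha|=r$. Write $LR(A\subseteq B)=\Gamma$ if $B/p^eA\cong N_{\gamma^{(e)}}$ for all $e\ge0$. For $X,Y\in\mathcal S_{r,\gamma}^\beta$ write $X\le_{\rm ext}Y$ if there are an integer $s\ge 0$ and exact sequences $0\to U_i\to H_i\to V_i\to0$ in $\mathcal S$ ($1\le i\le s$) with $X\cong H_1$, $U_i\oplus V_i\cong H_{i+1}$ for $1\le i\le s$ and $Y\cong H_{s+1}$; write $X\le_{\rm hom}Y$ if $\dim_k\mathrm{Hom}_{\mathcal S}(X,Z)\le\dim_k\mathrm{Hom}_{\mathcal S}(Y,Z)$ for every $Z\in\mathcal S$. For $\Delta,\Gamma\in\mathcal T_{r,\gamma}^\beta$ write $\Delta\le_{\rm ext}\Gamma$ (resp. $\Delta\le_{\rm hom}\Gamma$) if there is a finite sequence $\Delta=\Gamma^{(0)},\Gamma^{(1)},\dots,\Gamma^{(s)}=\Gamma$ in $\mathcal T_{r,\gamma}^\beta$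 such that for each $1\le i\le s$ there are $X,Y\in\mathcal S_{r,\gamma}^\beta$ with $LR(X)=\Gamma^{(i-1)}$, $LR(Y)=\Gamma^{(i)}$ and $X\le_{\rm ext}Y$ (resp. $X\le_{\rm hom}Y$). **Theorem.** Let $k$ be any field, $r\ge1$ an integer, and $\beta,\gamma$ partitions such that $\beta\setminus\gamma$ is a rook strip and $|\beta|-|\gamma|=r$. Then the four relations $\le_{\rm box}$, $\le_{\rm ext}$, $\le_{\rm hom}$ and $\le_{\rm dom}$ on $\mathcal T_{r,\gamma}^\beta$ coincide. -/

import Mathlib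

universe u

/-!
Conventions.  A partition `α = (α₁ ≥ α₂ ≥ …)` is represented by the Young diagram whose `j`-th
*column* (counted from `0`) has `α_{j+1}` cells.  With Mathlib's `YoungDiagram` (cells `(i, j)`,
`i` = row counted from the top, `j` = column) this reads `α_{j+1} = α.colLen j`; the parts of the
transposed partition are the row lengths `α.rowLen i`, and the weight is `α.card`.
-/

namespace LRInv

/-! ### Partitions and strips -/

/-- The natural order on partitions (of possibly different weights): `μ ≤ ν` iff
`∑_{i ≤ c} μ̄ᵢ ≤ ∑_{i ≤ c} ν̄ᵢ` for all `c`, where the bar denotes the transposed partition. -/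
def NatLE (μ ν : YoungDiagram) : Prop :=
  ∀ c : ℕ, ∑ i ∈ Finset.range c, μ.rowLen i ≤ ∑ i ∈ Finset.range c, ν.rowLen i

/-- `β ∖ γ` is a horizontal strip: `γ ⊆ β` and `βⱼ ≤ γⱼ + 1` for all `j`. -/
def IsHorizontalStrip (β γ : YoungDiagram) : Prop :=
  γ ≤ β ∧ ∀ j : ℕ, β.colLen j ≤ γ.colLen j + 1

/-- `β ∖ γ` is a vertical strip: the transposed skew diagram is a horizontal strip. -/
def IsVerticalStrip (β γ : YoungDiagram) : Prop :=
  IsHorizontalStrip β.transpose γ.transpose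

/-- `β ∖ γ` is a rook strip: both a horizontal and a vertical strip. -/
def IsRookStrip (β γ : YoungDiagram) : Prop :=
  IsHorizontalStrip β γ ∧ IsVerticalStrip β γ

/-! ### Littlewood-Richardson tableaux -/

/-- `t` is an LR-tableau of shape `β ∖ γ` and content `α`.  A filling of `β ∖ γ` is encoded as a
function on all positions `(row, column)` which is `0` exactly off `β ∖ γ`. -/
structure IsLRTableau (α β γ : YoungDiagram) (t : ℕ × ℕ → ℕ) : Prop where
  sub : γ ≤ β
  eq_zero : ∀ c, c ∉ β.cells \ γ.cells → t c = 0
  pos : ∀ c ∈ β.cells \ γ.cells, 1 ≤ t c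
  /-- the entry `e + 1` occurs `ᾱ_{e+1}` times -/
  content : ∀ e : ℕ, ((β.cells \ γ.cells).filter fun c => t c = e + 1).card = α.rowLen e
  /-- entries weakly increase along rows -/
  row_weak : ∀ i j j' : ℕ, j < j' → (i, j) ∈ β.cells \ γ.cells → (i, j') ∈ β.cells \ γ.cells →
    t (i, j) ≤ t (i, j')
  /-- entries strictly increase down columns -/
  col_strict : ∀ i i' j : ℕ, i < i' → (i, j) ∈ β.cells \ γ.cells → (i', j) ∈ β.cells \ γ.cells →
    t (i, j) < t (i', j)
  /-- lattice permutation property: among the columns with index at least `j` there are at least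
  as many entries `e + 1` as entries `e + 2` -/
  lattice : ∀ j e : ℕ,
    ((β.cells \ γ.cells).filter fun c => j ≤ c.2 ∧ t c = e + 2).card ≤
      ((β.cells \ γ.cells).filter fun c => j ≤ c.2 ∧ t c = e + 1).card

/-- The set of all LR-tableaux of shape `β ∖ γ` whose content is a partition of weight `r`. -/
def LRTableaux (r : ℕ) (β γ : YoungDiagram) : Set (ℕ × ℕ → ℕ) :=
  {t | ∃ α : YoungDiagram, α.card = r ∧ IsLRTableau α β γ t}

variable {r : ℕ} {β γ : YoungDiagram}

/-- The partition `γ⁽ᵉ⁾` of a tableau `Γ = [γ⁽⁰⁾, γ⁽¹⁾, …]`: all cells of `γ`, together with the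
cells of `β ∖ γ` whose entry is at most `e`. -/
def level (Γ : LRTableaux r β γ) (e : ℕ) : YoungDiagram where
  cells := β.cells.filter fun c => Γ.1 c ≤ e
  isLowerSet := by
    obtain ⟨t, α, -, h⟩ := Γ
    rintro ⟨i', j'⟩ ⟨i, j⟩ hle hmem
    obtain ⟨hi, hj⟩ : i ≤ i' ∧ j ≤ j' := hle
    simp only [Finset.coe_filter, Set.mem_ofPred_eq, YoungDiagram.mem_cells] at hmem ⊢
    obtain ⟨hβ, hte⟩ := hmem
    have hβ1 : (i, j) ∈ β := β.up_left_mem hi hj hβ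
    have hβ2 : (i', j) ∈ β := β.up_left_mem le_rfl hj hβ
    refine ⟨hβ1, ?_⟩
    by_cases hγ : (i, j) ∈ γ
    · rw [h.eq_zero (i, j) (by simp [hγ])]
      exact Nat.zero_le _
    · have hγ2 : (i', j) ∉ γ := fun hc => hγ (γ.up_left_mem hi le_rfl hc)
      have hγ3 : (i', j') ∉ γ := fun hc => hγ (γ.up_left_mem hi hj hc)
      have h1 : t (i, j) ≤ t (i', j) := by
        rcases hi.eq_or_lt with rfl | hlt
        · exact le_rfl
        · exact (h.col_strict i i' j hlt (by simp [hγ, hβ1]) (by simp [hγ2, hβ2])).le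
      have h2 : t (i', j) ≤ t (i', j') := by
        rcases hj.eq_or_lt with rfl | hlt
        · exact le_rfl
        · exact h.row_weak i' j j' hlt (by simp [hγ2, hβ2]) (by simp [hγ3, hβ])
      exact h1.trans (h2.trans hte)

/-! ### The two combinatorial orders -/

/-- `Δ ≺_box Γ`: `Δ` is obtained from `Γ` by a decreasing box move, that is, either by swapping two
entries so that the smaller one winds up in the lower position (here: the smaller entry of `Γ` is
in the cell `c`, the larger one in the cell `d` which lies in a lower row), or by increasing
one entry. -/
def BoxMove (Δ Γ : LRTableaux r β γ) : Prop :=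
  (∃ c ∈ β.cells \ γ.cells, ∃ d ∈ β.cells \ γ.cells,
      c.1 < d.1 ∧ Γ.1 c < Γ.1 d ∧ Δ.1 = Γ.1 ∘ Equiv.swap c d) ∨
    (∃ c ∈ β.cells \ γ.cells, ∃ m : ℕ, Γ.1 c < m ∧ Δ.1 = Function.update Γ.1 c m)

/-- The box order: the reflexive and transitive closure of `≺_box`. -/
def BoxLE (Δ Γ : LRTableaux r β γ) : Prop :=
  Relation.ReflTransGen BoxMove Δ Γ

/-- The dominance order. -/
def DomLE (Δ Γ : LRTableaux r β γ) : Prop :=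
  ∀ i ≤ r, NatLE (level Δ i) (level Γ i)

/-! ### Invariant subspaces of nilpotent linear operators -/

open Polynomial
open scoped Pointwise

/-- An embedding `(A ⊆ B)`: a finite dimensional `k[X]`-module `B` on which `X` acts nilpotently,
with a submodule `A`. -/
structure Embedding (k : Type u) [Field k] where
  B : Type u
  [addCommGroup : AddCommGroup B]
  [moduleK : Module k B]
  [modulePoly : Module k[X] B]
  [tower : IsScalarTower k k[X] B]
  [finite : FiniteDimensional k B]
  nilpotent : ∃ n : ℕ, ∀ b : B, (X ^ n : k[X]) • b = 0
  A : Submodule k[X] B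

attribute [instance] Embedding.addCommGroup Embedding.moduleK Embedding.modulePoly
  Embedding.tower Embedding.finite

variable {k : Type u} [Field k]

/-- The module `N_α = k[X]/(X^{α₁}) ⊕ k[X]/(X^{α₂}) ⊕ ⋯`. -/
abbrev NilpModule (k : Type u) [Field k] (α : YoungDiagram) : Type u :=
  ∀ j : Fin (α.rowLen 0), k[X] ⧸ Ideal.span {(X ^ α.colLen j : k[X])}

/-- The `k`-space `Hom_S(Y, Z)` of morphisms `(A ⊆ B) → (A' ⊆ B')`: the `k[X]`-linear maps
`f : B → B'` with `f(A) ⊆ A'`. -/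
noncomputable def Hom (Y Z : Embedding k) : Submodule k (Y.B →ₗ[k[X]] Z.B) where
  carrier := {f | ∀ a ∈ Y.A, f a ∈ Z.A}
  add_mem' hf hg a ha := Z.A.add_mem (hf a ha) (hg a ha)
  zero_mem' _ _ := Z.A.zero_mem
  smul_mem' c f hf a ha := by
    rw [LinearMap.smul_apply, ← algebraMap_smul k[X] c (f a)]
    exact Z.A.smul_mem _ (hf a ha)

/-- Isomorphism of embeddings. -/
def Iso (Y Z : Embedding k) : Prop :=
  ∃ f : Y.B ≃ₗ[k[X]] Z.B, ∀ b : Y.B, b ∈ Y.A ↔ f b ∈ Z.A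

/-- The direct sum of two embeddings. -/
noncomputable def Embedding.directSum (Y Z : Embedding k) : Embedding k where
  B := Y.B × Z.B
  nilpotent := by
    obtain ⟨m, hm⟩ := Y.nilpotent
    obtain ⟨n, hn⟩ := Z.nilpotent
    refine ⟨m + n, fun b => Prod.ext ?_ ?_⟩
    · change (X ^ (m + n) : k[X]) • b.1 = 0
      rw [pow_add, mul_comm, mul_smul, hm, smul_zero]
    · change (X ^ (m + n) : k[X]) • b.2 = 0
      rw [pow_add, mul_smul, hn, smul_zero]
  A := Y.A.prod Z.A

/-- There is a short exact sequence `0 → U → H → V → 0` of embeddings, that is, morphisms `f`, `g`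
such that both `0 → B_U → B_H → B_V → 0` and the restriction `0 → A_U → A_H → A_V → 0` are exact
(injectivity of `A_U → A_H` and `g ∘ f = 0` on `A_U` are inherited). -/
def ShortExact (U H V : Embedding k) : Prop :=
  ∃ f ∈ Hom U H, ∃ g ∈ Hom H V,
    Function.Injective f ∧ Function.Exact f g ∧ Function.Surjective g ∧
    (∀ a ∈ H.A, g a = 0 → ∃ a' ∈ U.A, f a' = a) ∧
    (∀ a'' ∈ V.A, ∃ a ∈ H.A, g a = a'')

/-- The relation `Y ≤_ext Z` for embeddings. -/
def Embedding.ExtLE (Y Z : Embedding k) : Prop :=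
  ∃ (s : ℕ) (H U V : ℕ → Embedding k),
    Iso Y (H 0) ∧
    (∀ i < s, ShortExact (U i) (H i) (V i) ∧ Iso ((U i).directSum (V i)) (H (i + 1))) ∧
    Iso Z (H s)

/-- The relation `Y ≤_hom Z` for embeddings: `dim Hom(Y, W) ≤ dim Hom(Z, W)` for every `W`. -/
def Embedding.HomLE (Y Z : Embedding k) : Prop :=
  ∀ W : Embedding k, Module.finrank k (Hom Y W) ≤ Module.finrank k (Hom Z W)

/-- `Y` lies in `S_{r,γ}^β`: `B ≅ N_β`, `B/A ≅ N_γ` and `A ≅ N_α` for a partition `α` of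
weight `r`. -/
def InCategory (r : ℕ) (β γ : YoungDiagram) (Y : Embedding k) : Prop :=
  Nonempty (Y.B ≃ₗ[k[X]] NilpModule k β) ∧
  Nonempty ((Y.B ⧸ Y.A) ≃ₗ[k[X]] NilpModule k γ) ∧
  ∃ α : YoungDiagram, α.card = r ∧ Nonempty (Y.A ≃ₗ[k[X]] NilpModule k α)

/-- `LR(Y) = Γ`, where `Γ = [γ⁽⁰⁾, γ⁽¹⁾, …]`: one has `B / X^e A ≅ N_{γ⁽ᵉ⁾}` for all `e`. -/
def HasTableau (Y : Embedding k) (Γ : LRTableaux r β γ) : Prop :=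
  ∀ e : ℕ, Nonempty ((Y.B ⧸ ((X ^ e : k[X]) • Y.A)) ≃ₗ[k[X]] NilpModule k (level Γ e))

/-! ### The two algebraic orders on LR-tableaux -/

variable (k)

/-- The ext order on LR-tableaux: chains of tableaux in which consecutive ones are the tableaux of
embeddings `Y`, `Z` in `S_{r,γ}^β` with `Y ≤_ext Z`. -/
def ExtLE (Δ Γ : LRTableaux r β γ) : Prop :=
  Relation.ReflTransGen
    (fun Δ' Γ' : LRTableaux r β γ => ∃ Y Z : Embedding k,
      InCategory r β γ Y ∧ InCategory r β γ Z ∧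
      HasTableau Y Δ' ∧ HasTableau Z Γ' ∧ Y.ExtLE Z) Δ Γ

/-- The hom order on LR-tableaux: chains of tableaux in which consecutive ones are the tableaux of
embeddings `Y`, `Z` in `S_{r,γ}^β` with `Y ≤_hom Z`. -/
def HomLE (Δ Γ : LRTableaux r β γ) : Prop :=
  Relation.ReflTransGen
    (fun Δ' Γ' : LRTableaux r β γ => ∃ Y Z : Embedding k,
      InCategory r β γ Y ∧ InCategory r β γ Z ∧
      HasTableau Y Δ' ∧ HasTableau Z Γ' ∧ Y.HomLE Z) Δ Γ

end LRInv

/-!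
Each row of the rook strip `β ∖ γ` contains at most one box, so a tableau is determined by its row
word `W`, where `W i` is the entry in row `i`, or `0` if there is none. The Littlewood-Richardson
condition says that `W` is a lattice word, and the dominance order compares, for all `e` and `n`,
the number of entries at most `e` in the first `n` rows.

Box moves only push entries down in this sense, so box implies dominance. Conversely, if `Δ` lies
strictly below `Γ` in the dominance order, there are a row `p` and a letter `b > W p` such that
raising the letter at `p` to `b`, and replacing the next letter `b` after `p` (if there is one) by
`W p`, gives a tableau which still dominates `Δ`. Such a lowering is a box move, and iterating it
joins `Γ` to `Δ`.

A lowering is also realized by an extension. The positions of `W` split into chains with letters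
`1, 2, 3, …`, the chain `q` consisting of the `q`-th occurrence of each letter. Let `E i` be the
generator of the summand of `N_β` in whose column the box of row `i` lies. The elements
`∑ X ^ (i + 1 - W i) • E i`, one for each chain, generate an embedding with row word `W`, and adding
`X ^ (p + 1 - b) • E p` to the generator of the chain that `p` joins yields one with the lowered
word. The projection to the columns of this chain exhibits the second embedding as an extension
whose direct sum of outer terms is the first.

Finally, ext implies hom because `dim Hom(-, Z)` is subadditive on short exact sequences, and hom
implies dominance because a morphism from `(A ⊆ B)` to `(ker X ^ e ⊆ k[X] / (X ^ c))` is a linear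
map from `B / X ^ e A` to `k[X] / (X ^ c)`, and the space of these has dimension equal to the sum
of the first `c` row lengths of `γ⁽ᵉ⁾`.
-/

namespace LRInv

open Polynomial
open scoped Pointwise

/-! ### Lattice words -/

section Words

/-- The number of letters `e` among the first `n` letters of the word `W`. Words are infinite, and
the letter `0` is a blank. -/
def letterCount (W : ℕ → ℕ) (e n : ℕ) : ℕ := Nat.count (fun i => W i = e) n

/-- The number of nonzero letters at most `e` among the first `n` letters of `W`. -/
def cumCount (W : ℕ → ℕ) (e n : ℕ) : ℕ := Nat.count (fun i => 1 ≤ W i ∧ W i ≤ e) n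

/-- `W` is a lattice word. -/
def IsLattice (W : ℕ → ℕ) : Prop :=
  ∀ n e : ℕ, 1 ≤ e → letterCount W (e + 1) n ≤ letterCount W e n

/-- The number of earlier letters equal to the letter in position `i`. The positions of a lattice
word with a given index form a chain which carries the letters `1, 2, 3, …` from top to bottom. -/
def colIndex (W : ℕ → ℕ) (i : ℕ) : ℕ := letterCount W (W i) i

variable {V W : ℕ → ℕ} {e i i' l n q : ℕ}

theorem letterCount_succ (W : ℕ → ℕ) (e n : ℕ) :
    letterCount W e (n + 1) = letterCount W e n + if W n = e then 1 else 0 :=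
  Nat.count_succ _ n

theorem letterCount_mono (W : ℕ → ℕ) (e : ℕ) : Monotone (letterCount W e) :=
  Nat.count_monotone _

theorem letterCount_congr (h : ∀ i < n, V i = W i) (e : ℕ) :
    letterCount V e n = letterCount W e n :=
  le_antisymm (Nat.count_mono_left fun i hi => (h i hi).symm.trans)
    (Nat.count_mono_left fun i hi => (h i hi).trans)

theorem letterCount_lt_letterCount (hi : W i = e) (h : i < n) :
    letterCount W e i < letterCount W e n :=
  Nat.count_strict_mono hi h

theorem exists_of_lt_letterCount (h : q < letterCount W e n) :
    ∃ i < n, W i = e ∧ letterCount W e i = q :=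
  have hq (hf : {i | W i = e}.Finite) : q < hf.toFinset.card := h.trans_le (Nat.count_le_card hf n)
  ⟨Nat.nth _ q, Nat.nth_lt_of_lt_count h, Nat.nth_mem q hq, Nat.count_nth hq⟩

theorem cumCount_succ (W : ℕ → ℕ) (e n : ℕ) :
    cumCount W e (n + 1) = cumCount W e n + if 1 ≤ W n ∧ W n ≤ e then 1 else 0 :=
  Nat.count_succ _ n

theorem cumCount_congr (h : ∀ i < n, V i = W i) (e : ℕ) : cumCount V e n = cumCount W e n :=
  le_antisymm (Nat.count_mono_left fun i hi => by rw [h i hi]; exact id)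
    (Nat.count_mono_left fun i hi => by rw [h i hi]; exact id)

theorem cumCount_add_sum_letterCount (W : ℕ → ℕ) {e b : ℕ} (h : e ≤ b) (n : ℕ) :
    cumCount W e n + ∑ f ∈ Finset.Ioc e b, letterCount W f n = cumCount W b n := by
  induction n with
  | zero => simp [cumCount, letterCount]
  | succ n ih =>
    have hterm : (∑ f ∈ Finset.Ioc e b, if W n = f then 1 else 0) =
        if e < W n ∧ W n ≤ b then 1 else 0 := by
      simp [Finset.mem_Ioc]
    simp only [cumCount_succ, letterCount_succ, Finset.sum_add_distrib, hterm]
    split_ifs <;> omega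

theorem eq_of_colIndex_eq (h : W i = W i') (hc : colIndex W i = colIndex W i') : i = i' :=
  Nat.count_injective (p := fun j => W j = W i) rfl h.symm <| by
    rw [colIndex, colIndex, ← h] at hc
    exact hc

namespace IsLattice

variable (hW : IsLattice W)
include hW

theorem exists_pred (he : 1 ≤ e) (hi : W i = e + 1) :
    ∃ i' < i, W i' = e ∧ colIndex W i' = colIndex W i := by
  have hle := hW (i + 1) e he
  rw [letterCount_succ, letterCount_succ, if_pos hi, if_neg (by omega), add_zero] at hle
  obtain ⟨i', hlt, he', hcount⟩ := exists_of_lt_letterCount (Nat.lt_of_succ_le hle)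
  exact ⟨i', hlt, he', by rw [colIndex, colIndex, he', hcount, hi]⟩

theorem exists_above (hl : 1 ≤ l) (hli : l ≤ W i) :
    ∃ i', i' + (W i - l) ≤ i ∧ W i' = l ∧ colIndex W i' = colIndex W i := by
  obtain ⟨d, hd⟩ := Nat.exists_eq_add_of_le hli
  induction d generalizing i with
  | zero => exact ⟨i, by omega, hd, rfl⟩
  | succ d ih =>
    obtain ⟨j, hji, hj, hcj⟩ := hW.exists_pred (e := l + d) (by omega) hd
    obtain ⟨i', hij, hi', hci⟩ := ih (i := j) (by omega) hj
    exact ⟨i', by omega, hi', hci.trans hcj⟩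

theorem add_sub_le (hi : 1 ≤ W i) (hii : W i ≤ W i') (hc : colIndex W i = colIndex W i') :
    i + (W i' - W i) ≤ i' := by
  obtain ⟨j, hj, hWj, hcj⟩ := hW.exists_above hi hii
  rwa [eq_of_colIndex_eq hWj (hcj.trans hc.symm)] at hj

theorem le_succ (i : ℕ) : W i ≤ i + 1 := by
  by_contra! h
  obtain ⟨j, hj, -⟩ := hW.exists_above (i := i) le_rfl (by omega)
  omega

theorem le_of_forall_colIndex_ne (h : ∀ i, W i = l + 1 → colIndex W i ≠ q)
    (hq : colIndex W i = q) : W i ≤ l := by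
  by_contra! hlt
  obtain ⟨j, -, hWj, hcj⟩ := hW.exists_above (Nat.le_add_left 1 l) hlt
  exact h j hWj (hcj.trans hq)

theorem letterCount_anti {f : ℕ} (he : 1 ≤ e) (hef : e ≤ f) (n : ℕ) :
    letterCount W f n ≤ letterCount W e n := by
  induction f, hef using Nat.le_induction with
  | base => exact le_rfl
  | succ f hf ih => exact (hW n f (he.trans hf)).trans ih

end IsLattice

end Words

/-! ### Lowering moves -/

section Lowering

/-- The first `n` letters of `W` include the position `p`, but no letter `b` after it. -/
def BeforeNext (W : ℕ → ℕ) (p b n : ℕ) : Prop := p < n ∧ letterCount W b n = letterCount W b p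

/-- `i` is the position of the first letter `b` after the position `p`. -/
def IsNext (W : ℕ → ℕ) (p b i : ℕ) : Prop := BeforeNext W p b i ∧ W i = b

open Classical in
/-- The word obtained from `W` by raising the letter in position `p` to `b`, and replacing the first
letter `b` after `p` (if there is one) by the old letter in position `p`. -/
noncomputable def lower (W : ℕ → ℕ) (p b i : ℕ) : ℕ :=
  if i = p then b else if IsNext W p b i then W p else W i

/-- The passage from `W` to `lower W p b` raises a letter and stays within the lattice words, and no
letter in `[W p, b)` occurs between `p` and the next letter `b`. -/
structure IsLowering (W : ℕ → ℕ) (p b : ℕ) : Prop where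
  pos : 1 ≤ W p
  lt : W p < b
  gap : ∀ i, BeforeNext W p b i → W i < W p ∨ b ≤ W i
  lattice : IsLattice W
  lattice_lower : IsLattice (lower W p b)

variable {V W : ℕ → ℕ} {b e i i' m n p : ℕ}

theorem IsNext.lt (h : IsNext W p b i) : p < i := h.1.1

theorem IsNext.colIndex_eq (h : IsNext W p b i) : colIndex W i = letterCount W b p := by
  rw [colIndex, h.2, h.1.2]

theorem IsNext.unique (h : IsNext W p b i) (h' : IsNext W p b i') : i = i' :=
  eq_of_colIndex_eq (h.2.trans h'.2.symm) (h.colIndex_eq.trans h'.colIndex_eq.symm)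

theorem beforeNext_succ (h : p < n) :
    BeforeNext W p b (n + 1) ↔ BeforeNext W p b n ∧ W n ≠ b := by
  have := letterCount_mono W b h.le
  simp only [BeforeNext, letterCount_succ]
  split_ifs <;> omega

theorem lower_self (W : ℕ → ℕ) (p b : ℕ) : lower W p b p = b := if_pos rfl

theorem lower_next (h : IsNext W p b i) : lower W p b i = W p := by
  rw [lower, if_neg h.lt.ne', if_pos h]

theorem lower_of_ne (h : i ≠ p) (h' : ¬ IsNext W p b i) : lower W p b i = W i := by
  rw [lower, if_neg h, if_neg h']

open Classical in
theorem count_lower (hb : W p ≠ b) (P : ℕ → Prop) [DecidablePred P] (n : ℕ) :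
    Nat.count (fun i => P (lower W p b i)) n + (if BeforeNext W p b n ∧ P (W p) then 1 else 0) =
      Nat.count (fun i => P (W i)) n + (if BeforeNext W p b n ∧ P b then 1 else 0) := by
  induction n with
  | zero => simp [BeforeNext]
  | succ n ih =>
    rw [Nat.count_succ, Nat.count_succ]
    rcases lt_trichotomy n p with h | rfl | h
    · have hn : ¬ BeforeNext W p b n := fun hn => h.asymm hn.1
      have hn' : ¬ BeforeNext W p b (n + 1) := fun hn => (Nat.lt_succ_iff.1 hn.1).not_gt h
      simp only [hn, hn', false_and, if_false, lower_of_ne h.ne fun h' => hn h'.1] at ih ⊢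
      omega
    · have hn : ¬ BeforeNext W n b n := fun hn => lt_irrefl n hn.1
      have hn' : BeforeNext W n b (n + 1) :=
        ⟨n.lt_succ_self, by rw [letterCount_succ, if_neg hb, add_zero]⟩
      simp only [hn, hn', false_and, true_and, if_false, lower_self] at ih ⊢
      omega
    · rw [beforeNext_succ h]
      by_cases hn : IsNext W p b n
      · simp only [hn.1, hn.2, ne_eq, not_true_eq_false, true_and, false_and, and_false, if_false,
          lower_next hn] at ih ⊢
        omega
      · have hiff : (BeforeNext W p b n ∧ W n ≠ b) ↔ BeforeNext W p b n :=
          and_iff_left_of_imp fun h' hWn => hn ⟨h', hWn⟩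
        simp only [hiff, lower_of_ne h.ne' hn]
        omega

open Classical in
theorem letterCount_lower (hb : W p ≠ b) (e n : ℕ) :
    letterCount (lower W p b) e n + (if BeforeNext W p b n ∧ W p = e then 1 else 0) =
      letterCount W e n + (if BeforeNext W p b n ∧ b = e then 1 else 0) :=
  count_lower hb (fun x => x = e) n

open Classical in
theorem cumCount_lower (hp : 1 ≤ W p) (hb : W p < b) (e n : ℕ) :
    cumCount (lower W p b) e n + (if BeforeNext W p b n ∧ W p ≤ e ∧ e < b then 1 else 0) =
      cumCount W e n := by
  have hcount := count_lower hb.ne (fun x => 1 ≤ x ∧ x ≤ e) n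
  simp only [cumCount]
  by_cases h : BeforeNext W p b n
  · simp only [h, true_and] at hcount ⊢
    split_ifs at hcount ⊢ <;> omega
  · simpa only [h, false_and, if_false, add_zero] using hcount

theorem cumCount_lower_lt (hp : 1 ≤ W p) (hb : W p < b) : cumCount (lower W p b) < cumCount W := by
  refine Pi.lt_def.2 ⟨fun e n => ?_, W p, Pi.lt_def.2 ⟨fun n => ?_, p + 1, ?_⟩⟩
  · rw [← cumCount_lower hp hb]
    exact Nat.le_add_right _ _
  · rw [← cumCount_lower hp hb]
    exact Nat.le_add_right _ _
  · have hp' : BeforeNext W p b (p + 1) :=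
      ⟨p.lt_succ_self, by rw [letterCount_succ, if_neg hb.ne, add_zero]⟩
    rw [← cumCount_lower hp hb, if_pos ⟨hp', le_rfl, hb⟩]
    exact Nat.lt_succ_self _

theorem exists_first_difference (hsupp : Function.support V = Function.support W)
    (hle : cumCount V ≤ cumCount W) (hne : V ≠ W) :
    ∃ m, (∀ i < m, V i = W i) ∧ 1 ≤ W m ∧ W m < V m := by
  classical
  have hex : ∃ i, V i ≠ W i := Function.ne_iff.1 hne
  obtain ⟨m, hm, hmin⟩ : ∃ m, V m ≠ W m ∧ ∀ i < m, V i = W i :=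
    ⟨Nat.find hex, Nat.find_spec hex, fun i hi => not_not.1 (Nat.find_min hex hi)⟩
  have h0 : V m ≠ 0 ↔ W m ≠ 0 := Set.ext_iff.1 hsupp m
  have hVm : cumCount V (V m) (m + 1) ≤ cumCount W (V m) (m + 1) := hle _ _
  rw [cumCount_succ, cumCount_succ, cumCount_congr hmin] at hVm
  refine ⟨m, hmin, ?_⟩
  split_ifs at hVm <;> omega

/-- In the stretch of `W` from the position `m` up to the next letter `b`, the largest letter below
`b` is `W p`, and `p` is its last position. -/
structure IsPivot (W : ℕ → ℕ) (m b p : ℕ) : Prop where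
  le : m ≤ p
  pos : 1 ≤ W p
  lt : W p < b
  count_eq : letterCount W b p = letterCount W b m
  max : ∀ i, m ≤ i → W i < b → letterCount W b i = letterCount W b m →
    W i < W p ∨ W i = W p ∧ i ≤ p

theorem exists_isPivot (hfin : (Function.support W).Finite) (hm : 1 ≤ W m) (hmb : W m < b) :
    ∃ p, IsPivot W m b p := by
  let T := {i ∈ Function.support W | m ≤ i ∧ W i < b ∧ letterCount W b i = letterCount W b m}
  obtain ⟨p, ⟨hp, hmp, hpb, hpc⟩, hmax⟩ := Set.exists_max_image T (fun i => toLex (W i, i))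
    (hfin.subset (Set.sep_subset _ _)) ⟨m, Nat.one_le_iff_ne_zero.1 hm, le_rfl, hmb, rfl⟩
  refine ⟨p, hmp, Nat.one_le_iff_ne_zero.2 hp, hpb, hpc, fun i hmi hib hic => ?_⟩
  rcases eq_or_ne (W i) 0 with h0 | h0
  · exact Or.inl (h0 ▸ Nat.pos_of_ne_zero hp)
  · exact Prod.Lex.toLex_le_toLex.1 (hmax i ⟨h0, hmi, hib, hic⟩)

namespace IsPivot

variable (h : IsPivot W m b p)
include h

theorem letterCount_eq (hmn : m ≤ n) (hn : letterCount W b n = letterCount W b m) {f : ℕ}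
    (hf : W p < f) (hfb : f ≤ b) : letterCount W f n = letterCount W f m := by
  induction n, hmn using Nat.le_induction with
  | base => rfl
  | succ n hmn ih =>
    have hmono := letterCount_mono W b hmn
    rw [letterCount_succ] at hn
    have hWn : W n ≠ b := fun hWn => by rw [if_pos hWn] at hn; omega
    rw [if_neg hWn, add_zero] at hn
    have hmax := h.max n hmn
    rw [letterCount_succ, if_neg (by omega), ih hn]
    rfl

theorem gap (i : ℕ) (hi : BeforeNext W p b i) : W i < W p ∨ b ≤ W i := by
  by_contra! hi'
  have hpi := hi.1
  have hmax := h.max i (h.le.trans hpi.le) hi'.2 (hi.2.trans h.count_eq)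
  omega

theorem isLattice_lower (hW : IsLattice W) (hb : letterCount W b m < letterCount W (b - 1) m) :
    IsLattice (lower W p b) := by
  intro n e he
  have hbp := h.lt
  have hlow := letterCount_lower hbp.ne e n
  have hlow' := letterCount_lower hbp.ne (e + 1) n
  have hWe := hW n e he
  by_cases hn : BeforeNext W p b n
  · have hmn : m ≤ n := h.le.trans hn.1.le
    have hconst {f : ℕ} := h.letterCount_eq (f := f) hmn (hn.2.trans h.count_eq)
    have hWp : letterCount W (W p) m < letterCount W (W p) n :=
      (letterCount_mono W _ h.le).trans_lt (letterCount_lt_letterCount rfl hn.1)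
    simp only [hn, true_and] at hlow hlow'
    rcases eq_or_ne b (e + 1) with rfl | heb
    · have hbn := hconst hbp le_rfl
      have hmono := letterCount_mono W e hmn
      rw [Nat.add_sub_cancel] at hb
      split_ifs at hlow hlow' with h₁ <;> first | omega | (rw [h₁] at hWp; omega)
    · rcases eq_or_ne (W p) e with rfl | hpe
      · have hsucc := hconst (lt_add_one (W p)) (by omega)
        have hWm := hW m (W p) he
        split_ifs at hlow hlow' <;> omega
      · split_ifs at hlow hlow' <;> omega
  · simp only [hn, false_and, if_false] at hlow hlow'
    omega

theorem cumCount_le_lower (hVW : ∀ i < m, V i = W i) (hVm : V m = b)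
    (hle : cumCount V ≤ cumCount W) : cumCount V ≤ cumCount (lower W p b) := by
  intro e n
  change cumCount V e n ≤ cumCount (lower W p b) e n
  have hlow := cumCount_lower h.pos h.lt e n
  have hen : cumCount V e n ≤ cumCount W e n := hle e n
  split_ifs at hlow with hn
  · obtain ⟨hn, hpe, heb⟩ := hn
    have hmn : m < n := h.le.trans_lt hn.1
    have hcount (f : ℕ) (hf : f ∈ Finset.Ioc e b) : letterCount W f n = letterCount V f m := by
      rw [Finset.mem_Ioc] at hf
      rw [h.letterCount_eq hmn.le (hn.2.trans h.count_eq) (hpe.trans_lt hf.1) hf.2,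
        letterCount_congr hVW]
    have hb : b ∈ Finset.Ioc e b := Finset.right_mem_Ioc.2 heb
    have hsum : ∑ f ∈ Finset.Ioc e b, letterCount W f n < ∑ f ∈ Finset.Ioc e b, letterCount V f n :=
      Finset.sum_lt_sum (fun f hf => (hcount f hf).trans_le (letterCount_mono V f hmn.le))
        ⟨b, hb, (hcount b hb).trans_lt (letterCount_lt_letterCount hVm hmn)⟩
    have hbn : cumCount V b n ≤ cumCount W b n := hle b n
    rw [← cumCount_add_sum_letterCount V heb.le, ← cumCount_add_sum_letterCount W heb.le] at hbn
    omega
  · omega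

end IsPivot

theorem exists_isLowering (hV : IsLattice V) (hW : IsLattice W)
    (hsupp : Function.support V = Function.support W) (hfin : (Function.support W).Finite)
    (hle : cumCount V ≤ cumCount W) (hne : V ≠ W) :
    ∃ p b, IsLowering W p b ∧ cumCount V ≤ cumCount (lower W p b) := by
  obtain ⟨m, hVW, hm, hmb⟩ := exists_first_difference hsupp hle hne
  obtain ⟨p, hp⟩ := exists_isPivot hfin hm hmb
  have hb : letterCount W (V m) m < letterCount W (V m - 1) m := by
    have hlat := hV (m + 1) (V m - 1) (by omega)
    rw [Nat.sub_add_cancel (by omega), letterCount_succ, letterCount_succ, if_pos rfl,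
      if_neg (by omega), letterCount_congr hVW, letterCount_congr hVW] at hlat
    exact hlat
  exact ⟨p, V m, ⟨hp.pos, hp.lt, hp.gap, hW, hp.isLattice_lower hW hb⟩,
    hp.cumCount_le_lower hVW rfl hle⟩

end Lowering

/-! ### Young diagrams -/

section YoungDiagrams

variable (α : YoungDiagram)

theorem rowLen_eq_of_mem_iff {α : YoungDiagram} {i n : ℕ} (h : ∀ j, (i, j) ∈ α ↔ j < n) :
    α.rowLen i = n :=
  eq_of_forall_lt_iff fun j => YoungDiagram.mem_iff_lt_rowLen.symm.trans (h j)

theorem colLen_eq_of_mem_iff {α : YoungDiagram} {j n : ℕ} (h : ∀ i, (i, j) ∈ α ↔ i < n) :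
    α.colLen j = n :=
  eq_of_forall_lt_iff fun i => YoungDiagram.mem_iff_lt_colLen.symm.trans (h i)

theorem card_transpose : α.transpose.card = α.card := Finset.card_map _

theorem sum_range_rowLen {N : ℕ} (hN : α.colLen 0 ≤ N) :
    ∑ i ∈ Finset.range N, α.rowLen i = α.card := by
  have hfst (c : ℕ × ℕ) (hc : c ∈ α.cells) : c.1 ∈ Finset.range N :=
    Finset.mem_range.2 <| (YoungDiagram.mem_iff_lt_colLen.1
      (α.up_left_mem le_rfl (Nat.zero_le c.2) hc)).trans_le hN
  rw [YoungDiagram.card, Finset.card_eq_sum_card_fiberwise hfst]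
  exact Finset.sum_congr rfl fun i _ => α.rowLen_eq_card

theorem sum_range_colLen {N : ℕ} (hN : α.rowLen 0 ≤ N) :
    ∑ j ∈ Finset.range N, α.colLen j = α.card := by
  simp only [← card_transpose α, ← α.rowLen_transpose]
  exact sum_range_rowLen _ ((α.colLen_transpose 0).trans_le hN)

theorem sum_min_colLen {N : ℕ} (hN : α.rowLen 0 ≤ N) (c : ℕ) :
    ∑ j ∈ Finset.range N, min c (α.colLen j) = ∑ i ∈ Finset.range c, α.rowLen i := by
  have hcol (j : ℕ) : min c (α.colLen j) = ∑ i ∈ Finset.range c, if (i, j) ∈ α then 1 else 0 := by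
    simp only [YoungDiagram.mem_iff_lt_colLen, Finset.sum_boole, Nat.cast_id]
    refine (Finset.card_range _).symm.trans (congrArg Finset.card (Finset.ext fun i => ?_))
    simp
  have hrow (i : ℕ) : α.rowLen i = ∑ j ∈ Finset.range N, if (i, j) ∈ α then 1 else 0 := by
    simp only [YoungDiagram.mem_iff_lt_rowLen, Finset.sum_boole, Nat.cast_id]
    refine (Finset.card_range _).symm.trans (congrArg Finset.card (Finset.ext fun j => ?_))
    have := α.rowLen_anti 0 i (Nat.zero_le i)
    simp only [Finset.mem_filter, Finset.mem_range]
    omega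
  simp only [hcol, hrow]
  exact Finset.sum_comm

theorem exists_rowLen_eq {f : ℕ → ℕ} (hf : Antitone f) {N : ℕ} (hN : f N = 0) :
    ∃ α : YoungDiagram, ∀ i, α.rowLen i = f i := by
  let w := List.ofFn fun i : Fin N => f i
  have hw : w.SortedGE := List.sortedGE_ofFn_iff.2 fun i j hij => hf hij
  refine ⟨YoungDiagram.ofRowLens w hw, fun i => rowLen_eq_of_mem_iff fun j => ?_⟩
  rw [YoungDiagram.mem_ofRowLens]
  simp only [w, List.length_ofFn, List.getElem_ofFn, exists_prop, and_iff_right_iff_imp]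
  intro hj
  by_contra! hi
  have := hf hi
  omega

end YoungDiagrams

/-! ### Rook strips -/

section RookStrips

/-- The rows which meet the skew diagram `β ∖ γ`. In a rook strip, the row `i` of `stripRows β γ`
has the only cell `(i, γ.rowLen i)`. -/
def stripRows (β γ : YoungDiagram) : Finset ℕ := (β.cells \ γ.cells).image Prod.fst

variable {r : ℕ} {β γ : YoungDiagram}

theorem mem_stripRows_of_mem {c : ℕ × ℕ} (hc : c ∈ β.cells \ γ.cells) : c.1 ∈ stripRows β γ :=
  Finset.mem_image_of_mem _ hc

theorem colLen_mem_stripRows {j : ℕ} (h : γ.colLen j < β.colLen j) :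
    γ.colLen j ∈ stripRows β γ := by
  refine mem_stripRows_of_mem (c := (γ.colLen j, j)) ?_
  simpa [YoungDiagram.mem_iff_lt_colLen] using h

namespace IsRookStrip

variable (hR : IsRookStrip β γ)
include hR

theorem le : γ ≤ β := hR.1.1

theorem colLen_le (j : ℕ) : β.colLen j ≤ γ.colLen j + 1 := hR.1.2 j

theorem rowLen_le (i : ℕ) : β.rowLen i ≤ γ.rowLen i + 1 := by
  simpa only [YoungDiagram.colLen_transpose] using hR.2.2 i

theorem eq_rowLen_of_mem {i j : ℕ} (h : (i, j) ∈ β.cells \ γ.cells) : j = γ.rowLen i := by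
  simp only [Finset.mem_sdiff, YoungDiagram.mem_cells, YoungDiagram.mem_iff_lt_rowLen] at h
  have := hR.rowLen_le i
  omega

theorem mem_stripRows_iff {i : ℕ} :
    i ∈ stripRows β γ ↔ (i, γ.rowLen i) ∈ β.cells \ γ.cells := by
  refine ⟨fun hi => ?_, fun h => mem_stripRows_of_mem h⟩
  obtain ⟨⟨i, j⟩, hc, rfl⟩ := Finset.mem_image.1 hi
  rwa [← hR.eq_rowLen_of_mem hc]

theorem card_filter_strip (P : ℕ × ℕ → Prop) [DecidablePred P] :
    ((β.cells \ γ.cells).filter P).card =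
      ((stripRows β γ).filter fun i => P (i, γ.rowLen i)).card := by
  have hstrip : β.cells \ γ.cells = (stripRows β γ).image fun i => (i, γ.rowLen i) := by
    ext ⟨i, j⟩
    simp only [Finset.mem_image, Prod.mk.injEq]
    constructor
    · exact fun h => ⟨i, mem_stripRows_of_mem h, rfl, (hR.eq_rowLen_of_mem h).symm⟩
    · rintro ⟨i, hi, rfl, rfl⟩
      exact hR.mem_stripRows_iff.1 hi
  rw [hstrip, Finset.filter_image,
    Finset.card_image_of_injective _ fun i i' h => congrArg Prod.fst h]

theorem card_stripRows (hw : β.card = γ.card + r) : (stripRows β γ).card = r := by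
  have hcard := hR.card_filter_strip fun _ => True
  simp only [Finset.filter_true] at hcard
  rw [← hcard, Finset.card_sdiff_of_subset hR.le]
  exact Nat.sub_eq_of_eq_add' hw

theorem colLen_rowLen {i : ℕ} (hi : i ∈ stripRows β γ) : γ.colLen (γ.rowLen i) = i := by
  have hc := hR.mem_stripRows_iff.1 hi
  have := hR.colLen_le (γ.rowLen i)
  simp only [Finset.mem_sdiff, YoungDiagram.mem_cells, YoungDiagram.mem_iff_lt_colLen] at hc
  omega

theorem outer_colLen_rowLen {i : ℕ} (hi : i ∈ stripRows β γ) :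
    β.colLen (γ.rowLen i) = i + 1 := by
  have hc := hR.mem_stripRows_iff.1 hi
  have := hR.colLen_le (γ.rowLen i)
  simp only [Finset.mem_sdiff, YoungDiagram.mem_cells, YoungDiagram.mem_iff_lt_colLen] at hc
  omega

theorem rowLen_colLen {j : ℕ} (h : γ.colLen j < β.colLen j) : γ.rowLen (γ.colLen j) = j := by
  refine (hR.eq_rowLen_of_mem ?_).symm
  simpa [YoungDiagram.mem_iff_lt_colLen] using h

theorem rowLen_lt_rowLen_iff {i i' : ℕ} (hi : i ∈ stripRows β γ) :
    γ.rowLen i < γ.rowLen i' ↔ i' < i := by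
  rw [← YoungDiagram.mem_iff_lt_rowLen, YoungDiagram.mem_iff_lt_colLen, hR.colLen_rowLen hi]

theorem funext_on_strip {s t : ℕ × ℕ → ℕ} (hs : ∀ c ∉ β.cells \ γ.cells, s c = 0)
    (ht : ∀ c ∉ β.cells \ γ.cells, t c = 0)
    (h : ∀ i, s (i, γ.rowLen i) = t (i, γ.rowLen i)) : s = t := by
  funext ⟨i, j⟩
  by_cases hc : (i, j) ∈ β.cells \ γ.cells
  · rw [hR.eq_rowLen_of_mem hc, h]
  · rw [hs _ hc, ht _ hc]

end IsRookStrip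

end RookStrips

/-! ### Row words -/

section RowWords

variable {r : ℕ} {β γ : YoungDiagram} {W : ℕ → ℕ}

/-- The row word of a filling of a rook strip. -/
def rowWord (Γ : LRTableaux r β γ) (i : ℕ) : ℕ := Γ.1 (i, γ.rowLen i)

/-- The words which are row words of LR-tableaux on the rook strip `β ∖ γ`. -/
structure IsRowWord (β γ : YoungDiagram) (W : ℕ → ℕ) : Prop where
  lattice : IsLattice W
  ne_zero_iff (i : ℕ) : W i ≠ 0 ↔ i ∈ stripRows β γ

/-- The filling of the rook strip `β ∖ γ` with row word `W`. -/
def filling (β γ : YoungDiagram) (W : ℕ → ℕ) (c : ℕ × ℕ) : ℕ :=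
  if c ∈ β.cells \ γ.cells then W c.1 else 0

theorem entry_eq_zero (Γ : LRTableaux r β γ) {c : ℕ × ℕ} (hc : c ∉ β.cells \ γ.cells) :
    Γ.1 c = 0 := by
  obtain ⟨α, -, hα⟩ := Γ.2
  exact hα.eq_zero c hc

theorem IsRookStrip.rowWord_injective (hR : IsRookStrip β γ) :
    Function.Injective (rowWord : LRTableaux r β γ → ℕ → ℕ) := fun Δ Γ h =>
  Subtype.ext <| hR.funext_on_strip (fun _ => entry_eq_zero Δ) (fun _ => entry_eq_zero Γ)
    (congrFun h)

theorem IsRookStrip.letterCount_eq_card (hR : IsRookStrip β γ)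
    (hW : ∀ i, W i ≠ 0 → i ∈ stripRows β γ) {t : ℕ × ℕ → ℕ}
    (ht : ∀ i ∈ stripRows β γ, t (i, γ.rowLen i) = W i) {j n : ℕ}
    (hj : ∀ i ∈ stripRows β γ, j ≤ γ.rowLen i ↔ i < n) {e : ℕ} (he : e ≠ 0) :
    letterCount W e n = ((β.cells \ γ.cells).filter fun c => j ≤ c.2 ∧ t c = e).card := by
  rw [hR.card_filter_strip, letterCount, Nat.count_eq_card_filter_range]
  congr 1
  ext i
  simp only [Finset.mem_filter, Finset.mem_range]
  constructor
  · rintro ⟨hi, rfl⟩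
    exact ⟨hW i he, (hj i (hW i he)).2 hi, ht i (hW i he)⟩
  · rintro ⟨hi, hji, hti⟩
    exact ⟨(hj i hi).1 hji, (ht i hi).symm.trans hti⟩

theorem IsRookStrip.isRowWord_rowWord (hR : IsRookStrip β γ) (Γ : LRTableaux r β γ) :
    IsRowWord β γ (rowWord Γ) := by
  obtain ⟨α, -, hα⟩ := Γ.2
  have hne (i : ℕ) : rowWord Γ i ≠ 0 ↔ i ∈ stripRows β γ := by
    rw [hR.mem_stripRows_iff]
    exact ⟨not_imp_comm.1 (hα.eq_zero _), fun hi => Nat.one_le_iff_ne_zero.1 (hα.pos _ hi)⟩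
  refine ⟨fun n e he => ?_, hne⟩
  obtain ⟨e, rfl⟩ := Nat.exists_eq_add_of_le' he
  rcases n with _ | n
  · simp [letterCount]
  · have hn (i : ℕ) (hi : i ∈ stripRows β γ) : γ.rowLen n ≤ γ.rowLen i ↔ i < n + 1 := by
      rw [← not_lt, hR.rowLen_lt_rowLen_iff hi, not_lt, Nat.lt_succ_iff]
    rw [hR.letterCount_eq_card (fun i => (hne i).1) (fun _ _ => rfl) hn (Nat.succ_ne_zero _),
      hR.letterCount_eq_card (fun i => (hne i).1) (fun _ _ => rfl) hn (Nat.succ_ne_zero _)]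
    exact hα.lattice (γ.rowLen n) e

namespace IsRowWord

variable (hW : IsRowWord β γ W)
include hW

theorem eq_zero {i : ℕ} (hi : i ∉ stripRows β γ) : W i = 0 :=
  not_imp_comm.1 (hW.ne_zero_iff i).1 hi

theorem support_eq : Function.support W = stripRows β γ := Set.ext hW.ne_zero_iff

theorem le_card (i : ℕ) : W i ≤ (stripRows β γ).card := by
  have hsub : Finset.Icc 1 (W i) ⊆ (stripRows β γ).image W := fun l hl => by
    rw [Finset.mem_Icc] at hl
    obtain ⟨i', -, rfl, -⟩ := hW.lattice.exists_above hl.1 hl.2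
    exact Finset.mem_image_of_mem W ((hW.ne_zero_iff i').1 (Nat.one_le_iff_ne_zero.1 hl.1))
  simpa using (Finset.card_le_card hsub).trans Finset.card_image_le

theorem cumCount_eq_card {N : ℕ} (hN : stripRows β γ ⊆ Finset.range N) :
    cumCount W N N = (stripRows β γ).card := by
  rw [cumCount, Nat.count_eq_card_filter_range]
  congr 1
  ext i
  have hle := hW.lattice.le_succ i
  have hi := hW.ne_zero_iff i
  simp only [Finset.mem_filter, Finset.mem_range, ← hi, ne_eq]
  refine ⟨fun h => by omega, fun h => ?_⟩
  have := Finset.mem_range.1 (hN (hi.1 h))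
  omega

theorem exists_content {N : ℕ} (hN : stripRows β γ ⊆ Finset.range N) :
    ∃ α : YoungDiagram, α.card = (stripRows β γ).card ∧
      ∀ e, α.rowLen e = letterCount W (e + 1) N := by
  have hzero : letterCount W (N + 1) N = 0 := Nat.count_iff_forall_not.2 fun i hi hWi => by
    have := hW.lattice.le_succ i
    omega
  obtain ⟨α, hα⟩ := exists_rowLen_eq (f := fun e => letterCount W (e + 1) N)
    (antitone_nat_of_succ_le fun e => hW.lattice N (e + 1) (Nat.le_add_left 1 e)) hzero
  have hcol : α.colLen 0 ≤ N := by
    by_contra! h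
    rw [← YoungDiagram.mem_iff_lt_colLen, YoungDiagram.mem_iff_lt_rowLen, hα, hzero] at h
    exact lt_irrefl 0 h
  refine ⟨α, ?_, hα⟩
  have hsum := cumCount_add_sum_letterCount W (Nat.zero_le N) N
  have hzero' : cumCount W 0 N = 0 := Nat.count_iff_forall_not.2 fun i _ => by omega
  rw [hW.cumCount_eq_card hN, hzero', zero_add, ← Finset.Ico_add_one_add_one_eq_Ioc,
    ← Finset.sum_Ico_add', ← Finset.range_eq_Ico] at hsum
  simp only [← hsum, ← sum_range_rowLen α hcol, hα]

theorem filling_rowLen (hR : IsRookStrip β γ) (i : ℕ) : filling β γ W (i, γ.rowLen i) = W i :=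
  ite_eq_left_iff.2 fun hi => (hW.eq_zero fun h => hi (hR.mem_stripRows_iff.1 h)).symm

theorem exists_rowWord_eq (hR : IsRookStrip β γ) (hw : β.card = γ.card + r) :
    ∃ Γ : LRTableaux r β γ, rowWord Γ = W := by
  obtain ⟨N, hN⟩ := Finset.exists_nat_subset_range (stripRows β γ)
  obtain ⟨α, hcard, hα⟩ := hW.exists_content hN
  have hcount {e j n : ℕ} := hR.letterCount_eq_card (j := j) (n := n) (e := e)
    (fun i => (hW.ne_zero_iff i).1) (fun i _ => hW.filling_rowLen hR i)
  refine ⟨⟨filling β γ W, α, hcard.trans (hR.card_stripRows hw), ?_⟩,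
    funext fun i => hW.filling_rowLen hR i⟩
  refine
    { sub := hR.le
      eq_zero := fun c hc => if_neg hc
      pos := fun c hc => ?_
      content := fun e => ?_
      row_weak := fun i j j' hj h h' => ?_
      col_strict := fun i i' j hi h h' => ?_
      lattice := fun j e => ?_ }
  · rw [filling, if_pos hc]
    exact Nat.one_le_iff_ne_zero.2 ((hW.ne_zero_iff _).2 (mem_stripRows_of_mem hc))
  · have hj (i : ℕ) (hi : i ∈ stripRows β γ) : 0 ≤ γ.rowLen i ↔ i < N := by
      simpa using hN hi
    rw [hα, hcount hj e.succ_ne_zero]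
    simp only [zero_le, true_and]
  · rw [hR.eq_rowLen_of_mem h, hR.eq_rowLen_of_mem h'] at hj
    exact absurd hj (lt_irrefl _)
  · have hlt := (hR.rowLen_lt_rowLen_iff (mem_stripRows_of_mem h')).2 hi
    rw [← hR.eq_rowLen_of_mem h, ← hR.eq_rowLen_of_mem h'] at hlt
    exact absurd hlt (lt_irrefl _)
  · obtain ⟨n, hn⟩ : ∃ n, ∀ i ∈ stripRows β γ, j ≤ γ.rowLen i ↔ i < n := by
      rcases j with _ | j
      · exact ⟨N, fun i hi => by simpa using hN hi⟩
      · refine ⟨γ.colLen j, fun i _ => ?_⟩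
        rw [Nat.succ_le_iff, ← YoungDiagram.mem_iff_lt_colLen, YoungDiagram.mem_iff_lt_rowLen]
    rw [← hcount hn (Nat.succ_ne_zero _), ← hcount hn (Nat.succ_ne_zero _)]
    exact hW.lattice n (e + 1) (Nat.le_add_left 1 e)

end IsRowWord

end RowWords

/-! ### Levels and the dominance order in terms of row words -/

section Levels

variable {r : ℕ} {β γ : YoungDiagram}

theorem mem_level {Γ : LRTableaux r β γ} {e : ℕ} {c : ℕ × ℕ} :
    c ∈ level Γ e ↔ c ∈ β ∧ Γ.1 c ≤ e := by
  simp [← YoungDiagram.mem_cells, level]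

theorem le_level (hle : γ ≤ β) (Γ : LRTableaux r β γ) (e : ℕ) : γ ≤ level Γ e := fun c hc =>
  mem_level.2 ⟨hle hc, by rw [entry_eq_zero Γ (by simp [hc])]; exact Nat.zero_le e⟩

theorem IsRookStrip.mem_level_iff (hR : IsRookStrip β γ) {Γ : LRTableaux r β γ} {e i j : ℕ} :
    (i, j) ∈ level Γ e ↔
      (i, j) ∈ γ ∨ (i, j) ∈ β.cells \ γ.cells ∧ rowWord Γ i ≤ e := by
  by_cases hγ : (i, j) ∈ γ
  · simp only [hγ, true_or, iff_true]
    exact le_level hR.le Γ e hγ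
  · by_cases hβ : (i, j) ∈ β
    · have hc : (i, j) ∈ β.cells \ γ.cells := by simp [hγ, hβ]
      rw [rowWord, ← hR.eq_rowLen_of_mem hc]
      simp [mem_level, hγ, hβ]
    · simp [mem_level, hγ, hβ]

theorem IsRookStrip.rowLen_level (hR : IsRookStrip β γ) (Γ : LRTableaux r β γ) (e i : ℕ) :
    (level Γ e).rowLen i =
      γ.rowLen i + if rowWord Γ i ≠ 0 ∧ rowWord Γ i ≤ e then 1 else 0 := by
  refine rowLen_eq_of_mem_iff fun j => ?_
  have hle := hR.rowLen_le i
  simp only [hR.mem_level_iff, (hR.isRowWord_rowWord Γ).ne_zero_iff, hR.mem_stripRows_iff,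
    Finset.mem_sdiff, YoungDiagram.mem_cells, YoungDiagram.mem_iff_lt_rowLen]
  split_ifs <;> omega

theorem IsRookStrip.colLen_level (hR : IsRookStrip β γ) (Γ : LRTableaux r β γ) (e j : ℕ) :
    (level Γ e).colLen j =
      if γ.colLen j < β.colLen j ∧ e < rowWord Γ (γ.colLen j) then γ.colLen j
      else β.colLen j := by
  refine colLen_eq_of_mem_iff fun i => ?_
  have hle := hR.colLen_le j
  have hsub : γ.colLen j ≤ β.colLen j := not_lt.1 fun h => lt_irrefl (β.colLen j) <|
    YoungDiagram.mem_iff_lt_colLen.1 (hR.le (YoungDiagram.mem_iff_lt_colLen.2 h))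
  rw [hR.mem_level_iff]
  simp only [Finset.mem_sdiff, YoungDiagram.mem_cells, YoungDiagram.mem_iff_lt_colLen]
  rcases lt_trichotomy i (γ.colLen j) with hi | rfl | hi <;> split_ifs <;> omega

theorem IsRookStrip.level_zero (hR : IsRookStrip β γ) (Γ : LRTableaux r β γ) :
    level Γ 0 = γ := by
  ext ⟨i, j⟩
  have hne := (hR.isRowWord_rowWord Γ).ne_zero_iff i
  rw [YoungDiagram.mem_cells, hR.mem_level_iff, YoungDiagram.mem_cells]
  refine or_iff_left fun h => hne.2 (mem_stripRows_of_mem h.1) (Nat.le_zero.1 h.2)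

theorem IsRookStrip.card_level_add (hR : IsRookStrip β γ) (Γ : LRTableaux r β γ) (e : ℕ) :
    (level Γ e).card + ((stripRows β γ).filter fun i => e < rowWord Γ i).card = β.card := by
  have hstrip : ((β.cells \ γ.cells).filter fun c => e < Γ.1 c) =
      β.cells.filter fun c => ¬Γ.1 c ≤ e := by
    ext c
    simp only [Finset.mem_filter, Finset.mem_sdiff, not_le]
    refine ⟨fun h => ⟨h.1.1, h.2⟩, fun h => ⟨⟨h.1, fun hc => ?_⟩, h.2⟩⟩
    rw [entry_eq_zero Γ (by simp [hc])] at h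
    exact Nat.not_lt_zero e h.2
  have hcard := hR.card_filter_strip fun c => e < Γ.1 c
  rw [hstrip] at hcard
  exact (congrArg _ hcard.symm).trans (Finset.card_filter_add_card_filter_not _)

theorem IsRookStrip.sum_rowLen_level (hR : IsRookStrip β γ) (Γ : LRTableaux r β γ) (e n : ℕ) :
    ∑ i ∈ Finset.range n, (level Γ e).rowLen i =
      ∑ i ∈ Finset.range n, γ.rowLen i + cumCount (rowWord Γ) e n := by
  simp only [hR.rowLen_level, Finset.sum_add_distrib, Finset.sum_boole, Nat.cast_id, cumCount,
    Nat.count_eq_card_filter_range, Nat.one_le_iff_ne_zero]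

theorem IsRookStrip.natLE_level_iff (hR : IsRookStrip β γ) {Δ Γ : LRTableaux r β γ} {e : ℕ} :
    NatLE (level Δ e) (level Γ e) ↔ cumCount (rowWord Δ) e ≤ cumCount (rowWord Γ) e := by
  simp only [NatLE, hR.sum_rowLen_level, add_le_add_iff_left, Pi.le_def]

theorem IsRowWord.cumCount_min {W : ℕ → ℕ} (hW : IsRowWord β γ W) (e : ℕ) :
    cumCount W (min e (stripRows β γ).card) = cumCount W e := by
  funext n
  simp only [cumCount, le_min_iff, hW.le_card, and_true]

theorem IsRookStrip.domLE_iff (hR : IsRookStrip β γ) (hw : β.card = γ.card + r)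
    {Δ Γ : LRTableaux r β γ} : DomLE Δ Γ ↔ cumCount (rowWord Δ) ≤ cumCount (rowWord Γ) := by
  simp only [DomLE, hR.natLE_level_iff]
  refine ⟨fun h e => ?_, fun h e _ => h e⟩
  rw [← (hR.isRowWord_rowWord Δ).cumCount_min, ← (hR.isRowWord_rowWord Γ).cumCount_min]
  exact h _ ((min_le_right _ _).trans (hR.card_stripRows hw).le)

end Levels

/-! ### The box order and the dominance order -/

section BoxOrder

variable {r : ℕ} {β γ : YoungDiagram} {Δ Γ : LRTableaux r β γ} {W : ℕ → ℕ} {p j b m : ℕ}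

theorem cumCount_comp_swap_add (hpj : p < j) (hp : 1 ≤ W p) (hlt : W p < W j) (e n : ℕ) :
    cumCount (W ∘ Equiv.swap p j) e n +
      (if p < n ∧ n ≤ j ∧ W p ≤ e ∧ e < W j then 1 else 0) = cumCount W e n := by
  induction n with
  | zero => simp [cumCount]
  | succ n ih =>
    rw [cumCount_succ, cumCount_succ, Function.comp_apply]
    by_cases hnp : n = p
    · subst hnp
      rw [Equiv.swap_apply_left]
      split_ifs at ih ⊢ <;> omega
    · by_cases hnj : n = j
      · subst hnj
        rw [Equiv.swap_apply_right]
        split_ifs at ih ⊢ <;> omega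
      · rw [Equiv.swap_apply_of_ne_of_ne hnp hnj]
        split_ifs at ih ⊢ <;> omega

theorem cumCount_update_le (hp : 1 ≤ W p) (hlt : W p < m) :
    cumCount (Function.update W p m) ≤ cumCount W := fun e n => by
  refine Nat.count_mono_left fun i _ => ?_
  rcases eq_or_ne i p with rfl | hi
  · rw [Function.update_self]
    omega
  · rw [Function.update_of_ne hi]
    exact id

theorem IsNext.lower_eq_comp_swap (h : IsNext W p b j) : lower W p b = W ∘ Equiv.swap p j := by
  funext i
  rw [Function.comp_apply]
  rcases eq_or_ne i p with rfl | hip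
  · rw [lower_self, Equiv.swap_apply_left, h.2]
  · rcases eq_or_ne i j with rfl | hij
    · rw [lower_next h, Equiv.swap_apply_right]
    · rw [lower_of_ne hip fun h' => hij (h'.unique h), Equiv.swap_apply_of_ne_of_ne hip hij]

theorem lower_eq_update (h : ∀ j, ¬ IsNext W p b j) : lower W p b = Function.update W p b := by
  funext i
  rcases eq_or_ne i p with rfl | hip
  · rw [lower_self, Function.update_self]
  · rw [lower_of_ne hip (h i), Function.update_of_ne hip]

theorem rowCell_injective (γ : YoungDiagram) : Function.Injective fun i => (i, γ.rowLen i) :=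
  fun _ _ h => congrArg Prod.fst h

theorem IsRookStrip.eq_comp_swap_iff (hR : IsRookStrip β γ) (hp : p ∈ stripRows β γ)
    (hj : j ∈ stripRows β γ) :
    Δ.1 = Γ.1 ∘ Equiv.swap (p, γ.rowLen p) (j, γ.rowLen j) ↔
      rowWord Δ = rowWord Γ ∘ Equiv.swap p j := by
  have hswap (i : ℕ) : rowWord Γ (Equiv.swap p j i) =
      Γ.1 (Equiv.swap (p, γ.rowLen p) (j, γ.rowLen j) (i, γ.rowLen i)) :=
    congrArg Γ.1 ((rowCell_injective γ).swap_apply p j i).symm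
  refine ⟨fun h => funext fun i => (congrFun h _).trans (hswap i).symm, fun h =>
    hR.funext_on_strip (fun _ => entry_eq_zero Δ) (fun c hc => ?_)
      fun i => (congrFun h i).trans (hswap i)⟩
  rw [Function.comp_apply, Equiv.swap_apply_of_ne_of_ne, entry_eq_zero Γ hc]
  · exact (ne_of_mem_of_not_mem (hR.mem_stripRows_iff.1 hp) hc).symm
  · exact (ne_of_mem_of_not_mem (hR.mem_stripRows_iff.1 hj) hc).symm

theorem IsRookStrip.eq_update_iff (hR : IsRookStrip β γ) (hp : p ∈ stripRows β γ) :
    Δ.1 = Function.update Γ.1 (p, γ.rowLen p) m ↔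
      rowWord Δ = Function.update (rowWord Γ) p m := by
  have hupdate := Function.update_comp_eq_of_injective Γ.1 (rowCell_injective γ) p m
  refine ⟨fun h => funext fun i => (congrFun h _).trans (congrFun hupdate i), fun h =>
    hR.funext_on_strip (fun _ => entry_eq_zero Δ) (fun c hc => ?_)
      fun i => (congrFun h i).trans (congrFun hupdate i).symm⟩
  rw [Function.update_of_ne (ne_of_mem_of_not_mem (hR.mem_stripRows_iff.1 hp) hc).symm,
    entry_eq_zero Γ hc]

theorem IsRookStrip.boxMove_iff (hR : IsRookStrip β γ) :
    BoxMove Δ Γ ↔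
      (∃ p j, p < j ∧ 1 ≤ rowWord Γ p ∧ rowWord Γ p < rowWord Γ j ∧
        rowWord Δ = rowWord Γ ∘ Equiv.swap p j) ∨
      ∃ p m, 1 ≤ rowWord Γ p ∧ rowWord Γ p < m ∧
        rowWord Δ = Function.update (rowWord Γ) p m := by
  have hmem {i : ℕ} : i ∈ stripRows β γ ↔ 1 ≤ rowWord Γ i :=
    ((hR.isRowWord_rowWord Γ).ne_zero_iff i).symm.trans Nat.one_le_iff_ne_zero.symm
  constructor
  · rintro (⟨⟨p, p'⟩, hp, ⟨j, j'⟩, hj, hpj, hlt, hΔ⟩ | ⟨⟨p, p'⟩, hp, m, hm, hΔ⟩)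
    · have hp' := mem_stripRows_of_mem hp
      have hj' := mem_stripRows_of_mem hj
      rw [hR.eq_rowLen_of_mem hp, hR.eq_rowLen_of_mem hj] at hlt hΔ
      exact Or.inl ⟨p, j, hpj, hmem.1 hp', hlt, (hR.eq_comp_swap_iff hp' hj').1 hΔ⟩
    · have hp' := mem_stripRows_of_mem hp
      rw [hR.eq_rowLen_of_mem hp] at hm hΔ
      exact Or.inr ⟨p, m, hmem.1 hp', hm, (hR.eq_update_iff hp').1 hΔ⟩
  · rintro (⟨p, j, hpj, hp, hlt, hΔ⟩ | ⟨p, m, hp, hm, hΔ⟩)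
    · have hp' := hmem.2 hp
      have hj' := hmem.2 (hp.trans hlt.le)
      exact Or.inl ⟨_, hR.mem_stripRows_iff.1 hp', _, hR.mem_stripRows_iff.1 hj', hpj, hlt,
        (hR.eq_comp_swap_iff hp' hj').2 hΔ⟩
    · have hp' := hmem.2 hp
      exact Or.inr ⟨_, hR.mem_stripRows_iff.1 hp', m, hm, (hR.eq_update_iff hp').2 hΔ⟩

theorem BoxMove.cumCount_le (hR : IsRookStrip β γ) (h : BoxMove Δ Γ) :
    cumCount (rowWord Δ) ≤ cumCount (rowWord Γ) := by
  obtain ⟨p, j, hpj, hp, hlt, hΔ⟩ | ⟨p, m, hp, hm, hΔ⟩ := hR.boxMove_iff.1 h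
  · rw [hΔ]
    exact fun e n => (cumCount_comp_swap_add hpj hp hlt e n).le.trans' (Nat.le_add_right _ _)
  · rw [hΔ]
    exact cumCount_update_le hp hm

theorem BoxLE.domLE (hR : IsRookStrip β γ) (hw : β.card = γ.card + r) (h : BoxLE Δ Γ) :
    DomLE Δ Γ := by
  rw [hR.domLE_iff hw]
  induction h with
  | refl => exact le_rfl
  | tail _ hmove ih => exact ih.trans (hmove.cumCount_le hR)

end BoxOrder

section LowerMoves

variable {r : ℕ} {β γ : YoungDiagram} {Δ Γ : LRTableaux r β γ} {W : ℕ → ℕ} {p b : ℕ}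

/-- `Δ` arises from `Γ` by a lowering of the row word. These are the box moves which will be
realized by extensions of embeddings. -/
def LowerMove (Δ Γ : LRTableaux r β γ) : Prop :=
  ∃ p b, IsLowering (rowWord Γ) p b ∧ rowWord Δ = lower (rowWord Γ) p b

theorem LowerMove.boxMove (hR : IsRookStrip β γ) (h : LowerMove Δ Γ) : BoxMove Δ Γ := by
  obtain ⟨p, b, hL, hΔ⟩ := h
  refine hR.boxMove_iff.2 ?_
  by_cases hnext : ∃ j, IsNext (rowWord Γ) p b j
  · obtain ⟨j, hj⟩ := hnext
    exact Or.inl ⟨p, j, hj.lt, hL.pos, hL.lt.trans_eq hj.2.symm, hΔ.trans hj.lower_eq_comp_swap⟩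
  · exact Or.inr ⟨p, b, hL.pos, hL.lt, hΔ.trans (lower_eq_update (not_exists.1 hnext))⟩

theorem IsLowering.lower_ne_zero_iff (hL : IsLowering W p b) (i : ℕ) :
    lower W p b i ≠ 0 ↔ W i ≠ 0 := by
  have hpos := hL.pos
  have hlt := hL.lt
  rcases eq_or_ne i p with rfl | hip
  · rw [lower_self]
    omega
  · by_cases hi : IsNext W p b i
    · rw [lower_next hi, hi.2]
      omega
    · rw [lower_of_ne hip hi]

theorem IsRowWord.lower (hW : IsRowWord β γ W) (hL : IsLowering W p b) :
    IsRowWord β γ (lower W p b) :=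
  ⟨hL.lattice_lower, fun i => (hL.lower_ne_zero_iff i).trans (hW.ne_zero_iff i)⟩

theorem DomLE.exists_lowerMove (hR : IsRookStrip β γ) (hw : β.card = γ.card + r)
    (h : DomLE Δ Γ) (hne : Δ ≠ Γ) : ∃ Γ', LowerMove Γ' Γ ∧ DomLE Δ Γ' := by
  have hΔ := hR.isRowWord_rowWord Δ
  have hΓ := hR.isRowWord_rowWord Γ
  obtain ⟨p, b, hL, hle⟩ := exists_isLowering hΔ.lattice hΓ.lattice
    (hΔ.support_eq.trans hΓ.support_eq.symm) (hΓ.support_eq ▸ Finset.finite_toSet _)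
    ((hR.domLE_iff hw).1 h) (hR.rowWord_injective.ne hne)
  obtain ⟨Γ', hΓ'⟩ := (hΓ.lower hL).exists_rowWord_eq hR hw
  exact ⟨Γ', ⟨p, b, hL, hΓ'⟩, (hR.domLE_iff hw).2 (hΓ' ▸ hle)⟩

theorem LowerMove.cumCount_lt (h : LowerMove Δ Γ) :
    cumCount (rowWord Δ) < cumCount (rowWord Γ) := by
  obtain ⟨p, b, hL, hΔ⟩ := h
  exact hΔ ▸ cumCount_lower_lt hL.pos hL.lt

theorem IsRookStrip.finite_lRTableaux (hR : IsRookStrip β γ) : Finite (LRTableaux r β γ) := by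
  let restrict (Γ : LRTableaux r β γ) (i : stripRows β γ) : Fin ((stripRows β γ).card + 1) :=
    ⟨rowWord Γ i, Nat.lt_succ_of_le ((hR.isRowWord_rowWord Γ).le_card i)⟩
  refine Finite.of_injective restrict fun Δ Γ h => hR.rowWord_injective (funext fun i => ?_)
  by_cases hi : i ∈ stripRows β γ
  · exact congrArg Fin.val (congrFun h ⟨i, hi⟩)
  · rw [(hR.isRowWord_rowWord Δ).eq_zero hi, (hR.isRowWord_rowWord Γ).eq_zero hi]

theorem DomLE.reflTransGen_lowerMove (hR : IsRookStrip β γ) (hw : β.card = γ.card + r)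
    (h : DomLE Δ Γ) : Relation.ReflTransGen LowerMove Δ Γ := by
  have := hR.finite_lRTableaux (r := r)
  have hwf : WellFounded
      (InvImage (· < ·) fun Γ : LRTableaux r β γ => cumCount (rowWord Γ)) :=
    Finite.wellFounded_of_trans_of_irrefl _
  induction Γ using hwf.induction with
  | _ Γ ih =>
    rcases eq_or_ne Δ Γ with rfl | hne
    · exact .refl
    · obtain ⟨Γ', hmove, hle⟩ := h.exists_lowerMove hR hw hne
      exact (ih Γ' hmove.cumCount_lt hle).tail hmove

theorem DomLE.boxLE (hR : IsRookStrip β γ) (hw : β.card = γ.card + r) (h : DomLE Δ Γ) :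
    BoxLE Δ Γ :=
  Relation.ReflTransGen.mono (fun _ _ hmove => hmove.boxMove hR) _ _
    (h.reflTransGen_lowerMove hR hw)

end LowerMoves

/-! ### Nilpotent modules -/

section NilpotentModules

theorem span_range_single_one {R ι : Type*} [CommRing R] [Finite ι] [DecidableEq ι]
    (I : ι → Ideal R) :
    Submodule.span R (Set.range fun i => (Pi.single i 1 : ∀ i, R ⧸ I i)) = ⊤ := by
  cases nonempty_fintype ι
  refine eq_top_iff.2 fun y _ => ?_
  rw [← Finset.univ_sum_single y]
  refine Submodule.sum_mem _ fun i _ => ?_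
  obtain ⟨f, hf⟩ := Ideal.Quotient.mk_surjective (y i)
  have hsingle : Pi.single i (y i) = f • (Pi.single i 1 : ∀ i, R ⧸ I i) := by
    rw [← Pi.single_smul, ← hf, ← Algebra.algebraMap_eq_smul_one, Ideal.Quotient.algebraMap_eq]
  exact hsingle ▸ Submodule.smul_mem _ f (Submodule.subset_span ⟨i, rfl⟩)

variable {k : Type u} [Field k]

instance finite_cyclic (n : ℕ) : Module.Finite k (k[X] ⧸ Ideal.span {(X ^ n : k[X])}) :=
  (monic_X_pow n).finite_quotient

theorem finrank_cyclic (n : ℕ) :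
    Module.finrank k (k[X] ⧸ Ideal.span {(X ^ n : k[X])}) = n :=
  finrank_quotient_span_eq_natDegree.trans (natDegree_X_pow n)

theorem X_pow_smul_cyclic {m n : ℕ} (h : m ≤ n) (x : k[X] ⧸ Ideal.span {(X ^ m : k[X])}) :
    (X ^ n : k[X]) • x = 0 := by
  obtain ⟨f, rfl⟩ := Ideal.Quotient.mk_surjective x
  exact Ideal.Quotient.eq_zero_iff_mem.2
    (Ideal.mem_span_singleton.2 ((pow_dvd_pow X h).mul_right f))

theorem finrank_nilpModule (α : YoungDiagram) : Module.finrank k (NilpModule k α) = α.card := by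
  simp only [Module.finrank_pi_fintype, finrank_cyclic]
  rw [Fin.sum_univ_eq_sum_range α.colLen, sum_range_colLen α le_rfl]

theorem colLen_eq_zero_iff {α : YoungDiagram} {j : ℕ} : α.colLen j = 0 ↔ α.rowLen 0 ≤ j := by
  rw [← not_lt, ← YoungDiagram.mem_iff_lt_rowLen, YoungDiagram.mem_iff_lt_colLen, Nat.not_lt,
    Nat.le_zero]

variable {M : Type*} [AddCommGroup M] [Module k M] [Module k[X] M] [IsScalarTower k k[X] M]

theorem exists_surjective_nilpModule {M : Type*} [AddCommGroup M] [Module k[X] M]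
    (α : YoungDiagram) (g : ℕ → M) (hg : ∀ j, (X ^ α.colLen j : k[X]) • g j = 0)
    (hspan : Submodule.span k[X] (Set.range g) = ⊤) :
    ∃ φ : NilpModule k α →ₗ[k[X]] M, Function.Surjective φ := by
  let φ : NilpModule k α →ₗ[k[X]] M := LinearMap.lsum k[X] _ k[X] fun j =>
    Submodule.liftQSpanSingleton (X ^ α.colLen j : k[X])
      (LinearMap.toSpanSingleton k[X] M (g j)) (hg j)
  have hφ (j : Fin (α.rowLen 0)) : φ (Pi.single j 1) = g j :=
    (LinearMap.lsum_piSingle ..).trans (one_smul k[X] (g j))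
  refine ⟨φ, LinearMap.range_eq_top.1 (eq_top_iff.2 ?_)⟩
  rw [← hspan, Submodule.span_le]
  rintro _ ⟨j, rfl⟩
  rcases lt_or_ge j (α.rowLen 0) with hj | hj
  · exact ⟨_, hφ ⟨j, hj⟩⟩
  · have hzero := hg j
    rw [colLen_eq_zero_iff.2 hj, pow_zero, one_smul] at hzero
    exact hzero ▸ Submodule.zero_mem _

theorem nonempty_equiv_nilpModule [FiniteDimensional k M] (α : YoungDiagram) (g : ℕ → M)
    (hg : ∀ j, (X ^ α.colLen j : k[X]) • g j = 0)
    (hspan : Submodule.span k[X] (Set.range g) = ⊤) (hcard : α.card ≤ Module.finrank k M) :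
    Nonempty (M ≃ₗ[k[X]] NilpModule k α) := by
  obtain ⟨φ, hsurj⟩ := exists_surjective_nilpModule α g hg hspan
  have heq : Module.finrank k (NilpModule k α) = Module.finrank k M :=
    le_antisymm (finrank_nilpModule (k := k) α ▸ hcard)
      (LinearMap.finrank_le_finrank_of_surjective (f := φ.restrictScalars k) hsurj)
  have hinj := (LinearMap.injective_iff_surjective_of_finrank_eq_finrank heq
    (f := φ.restrictScalars k)).2 hsurj
  exact ⟨(LinearEquiv.ofBijective φ ⟨hinj, hsurj⟩).symm⟩

theorem exists_perm_colLen {d : ℕ} (l : Fin d → ℕ) :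
    ∃ (α : YoungDiagram) (σ : Equiv.Perm (Fin d)),
      α.rowLen 0 ≤ d ∧ ∀ j : Fin d, α.colLen j = l (σ j) := by
  let σ := Tuple.sort (OrderDual.toDual ∘ l)
  have hσ : Antitone (l ∘ σ) := Tuple.monotone_sort (OrderDual.toDual ∘ l)
  let f (j : ℕ) : ℕ := if h : j < d then l (σ ⟨j, h⟩) else 0
  have hf : Antitone f := fun i j hij => by
    rcases lt_or_ge j d with hj | hj
    · simp only [f, hj, hij.trans_lt hj, dif_pos]
      exact hσ hij
    · simp [f, hj.not_gt]
  have hd : f d = 0 := dif_neg (lt_irrefl d)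
  obtain ⟨α, hα⟩ := exists_rowLen_eq hf hd
  simp only [← YoungDiagram.colLen_transpose] at hα
  exact ⟨α.transpose, σ, colLen_eq_zero_iff.1 ((hα d).trans hd),
    fun j => (hα j).trans (dif_pos j.2)⟩

theorem nonempty_equiv_nilpModule_of_equiv {d : ℕ} {l : Fin d → ℕ} {α : YoungDiagram}
    {σ : Equiv.Perm (Fin d)} (hd : α.rowLen 0 ≤ d) (hα : ∀ j : Fin d, α.colLen j = l (σ j))
    (ψ : (∀ i, k[X] ⧸ Ideal.span {(X ^ l i : k[X])}) ≃ₗ[k[X]] M) :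
    Nonempty (M ≃ₗ[k[X]] NilpModule k α) := by
  classical
  have : FiniteDimensional k M := Module.Finite.equiv (ψ.restrictScalars k)
  have hcard : α.card = Module.finrank k M := by
    rw [← (ψ.restrictScalars k).finrank_eq]
    simp only [Module.finrank_pi_fintype, finrank_cyclic]
    rw [← sum_range_colLen α hd, ← Equiv.sum_comp σ l, Finset.sum_range]
    simp only [hα]
  let g (j : ℕ) : M := if h : j < d then ψ (Pi.single (σ ⟨j, h⟩) 1) else 0
  have hg (j : Fin d) : g j = ψ (Pi.single (σ j) 1) := dif_pos j.2
  refine nonempty_equiv_nilpModule α g (fun j => ?_) ?_ hcard.le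
  · rcases lt_or_ge j d with hj | hj
    · rw [hα ⟨j, hj⟩, hg ⟨j, hj⟩, ← map_smul, ← Pi.single_smul, X_pow_smul_cyclic le_rfl,
        Pi.single_zero, map_zero]
    · rw [show g j = 0 from dif_neg hj.not_gt, smul_zero]
  · have hspan := congrArg (Submodule.map ψ.toLinearMap)
      (span_range_single_one fun i => Ideal.span {(X ^ l i : k[X])})
    rw [Submodule.map_span, Submodule.map_top, LinearEquiv.range] at hspan
    refine eq_top_iff.2 (hspan.ge.trans (Submodule.span_mono ?_))
    rintro _ ⟨_, ⟨i, rfl⟩, rfl⟩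
    exact ⟨σ.symm i, by rw [hg, Equiv.apply_symm_apply]; rfl⟩

theorem exists_equiv_nilpModule (M : Type*) [AddCommGroup M] [Module k M] [Module k[X] M]
    [IsScalarTower k k[X] M] [FiniteDimensional k M]
    (hM : ∃ n : ℕ, ∀ b : M, (X ^ n : k[X]) • b = 0) :
    ∃ α : YoungDiagram, Nonempty (M ≃ₗ[k[X]] NilpModule k α) := by
  have : Module.Finite k[X] M := Module.Finite.of_restrictScalars_finite k k[X] M
  obtain ⟨n, hn⟩ := hM
  obtain ⟨d, l, ⟨φ⟩⟩ := Module.torsion_by_prime_power_decomposition (M := M)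
    (irreducible_X (R := k)) (fun {x} => ⟨⟨X ^ n, n, rfl⟩, hn x⟩)
  obtain ⟨α, σ, hd, hα⟩ := exists_perm_colLen l
  exact ⟨α, nonempty_equiv_nilpModule_of_equiv hd hα
    (φ.trans (DirectSum.linearEquivFunOnFintype k[X] (Fin d) _)).symm⟩

end NilpotentModules

/-! ### From extensions to homomorphisms -/

section HomSpaces

variable {k : Type u} [Field k]

/-- Precomposition with a morphism of embeddings, the functoriality of `Hom` used to compare the
dimensions of `Hom` spaces. -/
noncomputable def Hom.precomp {Y Z : Embedding k} (φ : Y.B →ₗ[k[X]] Z.B) (hφ : φ ∈ Hom Y Z)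
    (W : Embedding k) : Hom Z W →ₗ[k] Hom Y W :=
  (LinearMap.lcomp k W.B φ).restrict fun _ hf a ha => hf _ (hφ a ha)

theorem Hom.precomp_injective {Y Z : Embedding k} {φ : Y.B →ₗ[k[X]] Z.B} (hφ : φ ∈ Hom Y Z)
    (hsurj : Function.Surjective φ) (W : Embedding k) :
    Function.Injective (Hom.precomp φ hφ W) := fun _ _ h =>
  Subtype.ext ((LinearMap.cancel_right hsurj).1 (congrArg Subtype.val h))

theorem Iso.symm {Y Z : Embedding k} (h : Iso Y Z) : Iso Z Y := by
  obtain ⟨f, hf⟩ := h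
  exact ⟨f.symm, fun b => by rw [hf, LinearEquiv.apply_symm_apply]⟩

theorem Iso.finrank_hom_le {Y Z : Embedding k} (h : Iso Y Z) (W : Embedding k) :
    Module.finrank k (Hom Z W) ≤ Module.finrank k (Hom Y W) := by
  obtain ⟨f, hf⟩ := h
  exact LinearMap.finrank_le_finrank_of_injective
    (Hom.precomp_injective (φ := f.toLinearMap) (fun a ha => (hf a).1 ha) f.surjective W)

theorem Iso.finrank_hom_eq {Y Z : Embedding k} (h : Iso Y Z) (W : Embedding k) :
    Module.finrank k (Hom Y W) = Module.finrank k (Hom Z W) :=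
  le_antisymm (h.symm.finrank_hom_le W) (h.finrank_hom_le W)

theorem finrank_hom_add_le (U V W : Embedding k) :
    Module.finrank k (Hom U W) + Module.finrank k (Hom V W) ≤
      Module.finrank k (Hom (U.directSum V) W) := by
  rw [← Module.finrank_prod]
  let coprod : Hom U W × Hom V W →ₗ[k] U.B × V.B →ₗ[k[X]] W.B :=
    (LinearMap.coprodEquiv k).toLinearMap ∘ₗ (Hom U W).subtype.prodMap (Hom V W).subtype
  have hcoprod (f) : coprod f ∈ Hom (U.directSum V) W := fun a ha =>
    W.A.add_mem (f.1.2 _ ha.1) (f.2.2 _ ha.2)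
  have hinj : Function.Injective coprod := (LinearMap.coprodEquiv k).injective.comp
    ((Hom U W).injective_subtype.prodMap (Hom V W).injective_subtype)
  exact LinearMap.finrank_le_finrank_of_injective (f := coprod.codRestrict _ hcoprod)
    ((LinearMap.injective_codRestrict_iff ..).2 hinj)

theorem exists_comp_eq_of_ker_le {R M N P : Type*} [Ring R] [AddCommGroup M] [Module R M]
    [AddCommGroup N] [Module R N] [AddCommGroup P] [Module R P] {g : M →ₗ[R] N} {φ : M →ₗ[R] P}
    (hg : Function.Surjective g) (hker : LinearMap.ker g ≤ LinearMap.ker φ) :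
    ∃ ψ : N →ₗ[R] P, ψ ∘ₗ g = φ := by
  refine ⟨(LinearMap.ker g).liftQ φ hker ∘ₗ (g.quotKerEquivOfSurjective hg).symm.toLinearMap,
    LinearMap.ext fun x => ?_⟩
  have hmk : (g.quotKerEquivOfSurjective hg).symm (g x) = Submodule.Quotient.mk x :=
    (LinearEquiv.symm_apply_eq _).2 rfl
  simp only [LinearMap.comp_apply, LinearEquiv.coe_coe, hmk]
  rfl

theorem ShortExact.finrank_hom_le {U H V : Embedding k} (h : ShortExact U H V) (W : Embedding k) :
    Module.finrank k (Hom H W) ≤ Module.finrank k (Hom U W) + Module.finrank k (Hom V W) := by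
  obtain ⟨f, hf, g, hg, -, hexact, hsurj, -, hA⟩ := h
  have hker : LinearMap.ker (Hom.precomp f hf W) ≤ LinearMap.range (Hom.precomp g hg W) := by
    intro φ hφ
    have hφf (u : U.B) : φ.1 (f u) = 0 :=
      LinearMap.congr_fun (congrArg Subtype.val (LinearMap.mem_ker.1 hφ)) u
    have hle : LinearMap.ker g ≤ LinearMap.ker φ.1 := fun x hx => by
      obtain ⟨u, rfl⟩ := (hexact x).1 hx
      exact hφf u
    obtain ⟨ψ, hψ⟩ := exists_comp_eq_of_ker_le hsurj hle
    refine ⟨⟨ψ, fun a ha => ?_⟩, Subtype.ext hψ⟩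
    obtain ⟨a', ha', rfl⟩ := hA a ha
    exact LinearMap.congr_fun hψ a' ▸ φ.2 a' ha'
  rw [← (Hom.precomp f hf W).finrank_range_add_finrank_ker]
  exact add_le_add (Submodule.finrank_le _)
    ((Submodule.finrank_mono hker).trans (LinearMap.finrank_range_le _))

theorem Embedding.ExtLE.homLE {Y Z : Embedding k} (h : Y.ExtLE Z) : Y.HomLE Z := by
  obtain ⟨s, H, U, V, hY, hstep, hZ⟩ := h
  intro W
  rw [hY.finrank_hom_eq, hZ.finrank_hom_eq]
  suffices ∀ i ≤ s, Module.finrank k (Hom (H 0) W) ≤ Module.finrank k (Hom (H i) W) from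
    this s le_rfl
  intro i hi
  induction i with
  | zero => exact le_rfl
  | succ i ih =>
    obtain ⟨hexact, hiso⟩ := hstep i hi
    calc Module.finrank k (Hom (H 0) W)
        ≤ Module.finrank k (Hom (H i) W) := ih (Nat.le_of_succ_le hi)
      _ ≤ Module.finrank k (Hom (U i) W) + Module.finrank k (Hom (V i) W) :=
          hexact.finrank_hom_le W
      _ ≤ Module.finrank k (Hom ((U i).directSum (V i)) W) := finrank_hom_add_le ..
      _ = Module.finrank k (Hom (H (i + 1)) W) := hiso.finrank_hom_eq W

theorem ExtLE.homLE {r : ℕ} {β γ : YoungDiagram} {Δ Γ : LRTableaux r β γ} (h : ExtLE k Δ Γ) :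
    HomLE k Δ Γ :=
  Relation.ReflTransGen.mono
    (fun _ _ ⟨Y, Z, hY, hZ, hΔ, hΓ, hYZ⟩ => ⟨Y, Z, hY, hZ, hΔ, hΓ, hYZ.homLE⟩) _ _ h

/-! ### From homomorphisms to dominance -/

/-- A homomorphism out of `k[X]/(X^l)` is determined by the image of `1`, an element annihilated
by `X ^ l`. -/
noncomputable def cyclicHomEquiv (l : ℕ) (N : Type*) [AddCommGroup N] [Module k N] [Module k[X] N]
    [IsScalarTower k k[X] N] :
    ((k[X] ⧸ Ideal.span {(X ^ l : k[X])}) →ₗ[k[X]] N) ≃ₗ[k]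
      LinearMap.ker ((LinearMap.lsmul k[X] N (X ^ l : k[X])).restrictScalars k) where
  toFun f := ⟨f 1, by
    simp only [LinearMap.mem_ker, LinearMap.coe_restrictScalars, LinearMap.lsmul_apply]
    rw [← map_smul, X_pow_smul_cyclic le_rfl, map_zero]⟩
  map_add' _ _ := rfl
  map_smul' _ _ := rfl
  invFun x := Submodule.liftQSpanSingleton (X ^ l : k[X]) (LinearMap.toSpanSingleton k[X] N x.1) x.2
  left_inv f := Submodule.linearMap_qext _ (LinearMap.ext_ring (one_smul k[X] (f 1)))
  right_inv x := Subtype.ext (one_smul k[X] x.1)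

theorem X_pow_dvd_X_pow_mul_iff {l c : ℕ} {p : k[X]} : X ^ c ∣ X ^ l * p ↔ X ^ (c - l) ∣ p := by
  rcases le_total l c with h | h
  · conv_lhs => rw [← Nat.add_sub_cancel' h, pow_add]
    exact mul_dvd_mul_iff_left (pow_ne_zero _ X_ne_zero)
  · rw [Nat.sub_eq_zero_of_le h, pow_zero]
    exact iff_of_true ((pow_dvd_pow _ h).mul_right _) (one_dvd _)

theorem finrank_range_X_pow_smul_cyclic (l c : ℕ) :
    Module.finrank k (LinearMap.range (LinearMap.lsmul k[X]
      (k[X] ⧸ Ideal.span {(X ^ c : k[X])}) (X ^ l))) = c - l := by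
  set I : Ideal k[X] := Ideal.span {(X ^ c : k[X])}
  let ν : k[X] →ₗ[k[X]] k[X] ⧸ I := LinearMap.lsmul k[X] (k[X] ⧸ I) (X ^ l) ∘ₗ I.mkQ
  have hker : LinearMap.ker ν = Ideal.span {(X ^ (c - l) : k[X])} := by
    ext p
    rw [Ideal.mem_span_singleton, ← X_pow_dvd_X_pow_mul_iff, ← Ideal.mem_span_singleton]
    exact Ideal.Quotient.eq_zero_iff_mem
  have hrange : LinearMap.range ν = LinearMap.range (LinearMap.lsmul k[X] (k[X] ⧸ I) (X ^ l)) := by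
    rw [LinearMap.range_comp, Submodule.range_mkQ, Submodule.map_top]
  rw [← hrange, ← (ν.quotKerEquivRange.restrictScalars k).finrank_eq, hker, finrank_cyclic]

theorem finrank_cyclic_hom (l c : ℕ) :
    Module.finrank k ((k[X] ⧸ Ideal.span {(X ^ l : k[X])}) →ₗ[k[X]]
      (k[X] ⧸ Ideal.span {(X ^ c : k[X])})) = min c l := by
  let μ := LinearMap.lsmul k[X] (k[X] ⧸ Ideal.span {(X ^ c : k[X])}) (X ^ l)
  have hrange : Module.finrank k (LinearMap.range (μ.restrictScalars k)) = c - l :=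
    finrank_range_X_pow_smul_cyclic l c
  have hrank := (μ.restrictScalars k).finrank_range_add_finrank_ker
  rw [hrange, finrank_cyclic] at hrank
  rw [(cyclicHomEquiv l _).finrank_eq]
  change Module.finrank k (LinearMap.ker (μ.restrictScalars k)) = min c l
  omega

/-- The embedding of the elements annihilated by `X ^ e` into `k[X] / (X ^ c)`, the test object
that reads the first `c` rows of the `e`-th partition of a tableau off a `Hom` space. -/
noncomputable def cyclicEmbedding (k : Type u) [Field k] (e c : ℕ) : Embedding k where
  B := k[X] ⧸ Ideal.span {(X ^ c : k[X])}
  nilpotent := ⟨c, fun b => by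
    obtain ⟨p, rfl⟩ := Ideal.Quotient.mk_surjective b
    rw [← Ideal.Quotient.algebraMap_eq, Algebra.algebraMap_eq_smul_one, smul_comm,
      X_pow_smul_cyclic le_rfl, smul_zero]⟩
  A := LinearMap.ker (LinearMap.lsmul k[X] _ (X ^ e : k[X]))

/-- `Hom(Y, (ker X ^ e ⊆ k[X] / (X ^ c))) = Hom(B / X ^ e A, k[X] / (X ^ c))`. -/
noncomputable def homCyclicEquiv (Y : Embedding k) (e c : ℕ) :
    Hom Y (cyclicEmbedding k e c) ≃ₗ[k]
      ((Y.B ⧸ ((X ^ e : k[X]) • Y.A)) →ₗ[k[X]] (k[X] ⧸ Ideal.span {(X ^ c : k[X])})) where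
  toFun f := Submodule.liftQ _ f.1 (by
    rintro _ ⟨a, ha, rfl⟩
    exact (map_smul f.1 _ _).trans (f.2 a ha))
  map_add' _ _ := Submodule.linearMap_qext _ rfl
  map_smul' _ _ := Submodule.linearMap_qext _ rfl
  invFun g := ⟨g.comp (Submodule.mkQ _), fun a ha => by
    change (X ^ e : k[X]) • g (Submodule.Quotient.mk a) = 0
    rw [← map_smul, ← Submodule.Quotient.mk_smul,
      (Submodule.Quotient.mk_eq_zero _).2 (Submodule.smul_mem_pointwise_smul _ _ _ ha), map_zero]⟩
  left_inv _ := rfl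
  right_inv _ := Submodule.linearMap_qext _ rfl

theorem finrank_hom_cyclicEmbedding {Y : Embedding k} {e : ℕ} {α : YoungDiagram}
    (h : Nonempty ((Y.B ⧸ ((X ^ e : k[X]) • Y.A)) ≃ₗ[k[X]] NilpModule k α)) (c : ℕ) :
    Module.finrank k (Hom Y (cyclicEmbedding k e c)) = ∑ i ∈ Finset.range c, α.rowLen i := by
  obtain ⟨f⟩ := h
  have (j : Fin (α.rowLen 0)) : Module.Free k ((k[X] ⧸ Ideal.span {(X ^ α.colLen j : k[X])})
      →ₗ[k[X]] (k[X] ⧸ Ideal.span {(X ^ c : k[X])})) := .of_divisionRing ..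
  rw [(homCyclicEquiv Y e c).finrank_eq, (f.congrLeft _ k).finrank_eq,
    ← (LinearMap.lsum k[X] (fun j : Fin (α.rowLen 0) => k[X] ⧸ Ideal.span {(X ^ α.colLen j : k[X])})
      k).finrank_eq, Module.finrank_pi_fintype]
  simp only [finrank_cyclic_hom]
  rw [Fin.sum_univ_eq_sum_range fun j => min c (α.colLen j), sum_min_colLen α le_rfl]

theorem HomLE.domLE {r : ℕ} {β γ : YoungDiagram} {Δ Γ : LRTableaux r β γ} (h : HomLE k Δ Γ) :
    DomLE Δ Γ := by
  induction h with
  | refl => exact fun i _ c => le_rfl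
  | tail _ hstep ih =>
    obtain ⟨Y, Z, -, -, hΔ, hΓ, hYZ⟩ := hstep
    refine fun i hi c => (ih i hi c).trans ?_
    have hle := hYZ (cyclicEmbedding k i c)
    rwa [finrank_hom_cyclicEmbedding (hΔ i), finrank_hom_cyclicEmbedding (hΓ i)] at hle

end HomSpaces

/-! ### Split extensions -/

section SplitExtensions

variable {k : Type u} [Field k]

theorem finrank_map_add_finrank_inf_ker {R M N : Type*} [Ring R] [SMul k R] [AddCommGroup M]
    [Module k M] [Module R M] [IsScalarTower k R M] [FiniteDimensional k M] [AddCommGroup N]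
    [Module k N] [Module R N] [IsScalarTower k R N] (f : M →ₗ[R] N) (D : Submodule R M) :
    Module.finrank k (D.map f) + Module.finrank k (D ⊓ LinearMap.ker f : Submodule R M) =
      Module.finrank k D := by
  have : FiniteDimensional k D :=
    FiniteDimensional.finiteDimensional_submodule (D.restrictScalars k)
  have hrank := ((f.domRestrict D).restrictScalars k).finrank_range_add_finrank_ker
  have hker := ((D.equivSubtypeMap (LinearMap.ker (f.domRestrict D))).restrictScalars k).finrank_eq
  rw [LinearMap.ker_domRestrict, Submodule.map_comap_subtype] at hker
  rw [LinearMap.range_restrictScalars, LinearMap.range_domRestrict] at hrank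
  rw [← hker, ← LinearMap.ker_domRestrict]
  exact hrank

theorem Iso.refl (Y : Embedding k) : Iso Y Y := ⟨LinearEquiv.refl _ _, fun _ => Iff.rfl⟩

theorem ShortExact.extLE {U H V Z : Embedding k} (hexact : ShortExact U H V)
    (hiso : Iso (U.directSum V) Z) : H.ExtLE Z := by
  refine ⟨1, fun i => if i = 0 then H else Z, fun _ => U, fun _ => V, Iso.refl _, fun i hi => ?_,
    Iso.refl _⟩
  obtain rfl := Nat.lt_one_iff.1 hi
  exact ⟨hexact, hiso⟩

/-- The embedding `(A ⊆ B)` in the ambient module `B` of `Y`. -/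
def Embedding.withSub (Y : Embedding k) (A : Submodule k[X] Y.B) : Embedding k :=
  { Y with A := A }

/-- The embedding `(A ∩ C ⊆ C)`, for submodules `A` and `C` of the ambient module of `Y`; it is
used for the kernel and the image of an endomorphism. -/
noncomputable def Embedding.restrict (Y : Embedding k) (C A : Submodule k[X] Y.B) :
    Embedding k where
  B := C
  finite := FiniteDimensional.of_injective (C.subtype.restrictScalars k) C.injective_subtype
  nilpotent := Y.nilpotent.imp fun _ hn b => Subtype.ext (hn b.1)
  A := A.comap C.subtype

variable {Y : Embedding k} {A A' : Submodule k[X] Y.B} {π : Y.B →ₗ[k[X]] Y.B}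

theorem Embedding.restrict_congr {C : Submodule k[X] Y.B} (h : A ⊓ C = A' ⊓ C) :
    Y.restrict C A = Y.restrict C A' := by
  have hcomap (D : Submodule k[X] Y.B) : (D ⊓ C).comap C.subtype = D.comap C.subtype := by
    rw [Submodule.comap_inf, Submodule.comap_subtype_self, inf_top_eq]
  simp only [restrict, ← hcomap A, ← hcomap A', h]

theorem shortExact_ker_range (Y : Embedding k) (A : Submodule k[X] Y.B) (π : Y.B →ₗ[k[X]] Y.B) :
    ShortExact (Y.restrict (LinearMap.ker π) A) (Y.withSub A)
      (Y.restrict (LinearMap.range π) (A.map π)) := by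
  refine ⟨(LinearMap.ker π).subtype, fun _ hu => hu, π.rangeRestrict,
    fun _ hb => Submodule.mem_map_of_mem hb, Submodule.injective_subtype _, fun b => ?_,
    π.surjective_rangeRestrict, fun b hb h => ⟨⟨b, congrArg Subtype.val h⟩, hb, rfl⟩, ?_⟩
  · exact ⟨fun h => ⟨⟨b, congrArg Subtype.val h⟩, rfl⟩, fun ⟨u, hu⟩ => Subtype.ext (hu ▸ u.2)⟩
  · rintro v ⟨b, hb, hbv⟩
    exact ⟨b, hb, Subtype.ext hbv⟩

theorem iso_directSum_ker_range (hπ : IsIdempotentElem π) (hA : A.map π ≤ A) :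
    Iso ((Y.restrict (LinearMap.ker π) A).directSum (Y.restrict (LinearMap.range π) (A.map π)))
      (Y.withSub A) := by
  refine ⟨Submodule.prodEquivOfIsCompl _ _ (LinearMap.IsIdempotentElem.isCompl hπ).symm, ?_⟩
  rintro ⟨u, v⟩
  have hv : π (u.1 + v.1) = v.1 := by
    rw [map_add, LinearMap.mem_ker.1 u.2, zero_add,
      (LinearMap.IsIdempotentElem.mem_range_iff hπ).1 v.2]
  change (u.1 ∈ A ∧ v.1 ∈ A.map π) ↔ u.1 + v.1 ∈ A
  refine ⟨fun ⟨hu, hv⟩ => A.add_mem hu (hA hv), fun h => ?_⟩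
  have hvA : v.1 ∈ A.map π := ⟨_, h, hv⟩
  exact ⟨(A.add_mem_iff_left (hA hvA)).1 h, hvA⟩

theorem extLE_withSub (hπ : IsIdempotentElem π) (hmap : A'.map π = A.map π)
    (hker : A' ⊓ LinearMap.ker π = A ⊓ LinearMap.ker π) (hA : A.map π ≤ A) :
    (Y.withSub A').ExtLE (Y.withSub A) := by
  refine (shortExact_ker_range Y A' π).extLE ?_
  rw [hmap, Embedding.restrict_congr hker]
  exact iso_directSum_ker_range hπ hA

theorem map_sup_span_singleton {R M N : Type*} [Ring R] [AddCommGroup M] [Module R M]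
    [AddCommGroup N] [Module R N] {f : M →ₗ[R] N} {D : Submodule R M}
    (hD : D ≤ LinearMap.ker f) (x : M) :
    (D ⊔ Submodule.span R {x}).map f = Submodule.span R {f x} := by
  rw [Submodule.map_sup, LinearMap.le_ker_iff_map.1 hD, bot_sup_eq, Submodule.map_span,
    Set.image_singleton]

theorem sup_span_singleton_inf_ker {R M : Type*} [Ring R] [AddCommGroup M] [Module R M]
    {f : M →ₗ[R] M} {D : Submodule R M} {x : M} (hD : D ≤ LinearMap.ker f) (hx : f x = x) :
    (D ⊔ Submodule.span R {x}) ⊓ LinearMap.ker f = D := by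
  refine le_antisymm ?_ (le_inf le_sup_left hD)
  rintro _ ⟨hmem, hker⟩
  obtain ⟨d, hd, y, hy, rfl⟩ := Submodule.mem_sup.1 hmem
  obtain ⟨c, rfl⟩ := Submodule.mem_span_singleton.1 hy
  rw [SetLike.mem_coe, LinearMap.mem_ker, map_add, hD hd, map_smul, hx, zero_add] at hker
  rwa [hker, add_zero]

theorem extLE_sup_span_singleton (hπ : IsIdempotentElem π) {D : Submodule k[X] Y.B} {a a' : Y.B}
    (hD : D ≤ LinearMap.ker π) (ha : π a = a) (ha' : π a' = a)
    (hdim : Module.finrank k (D ⊔ Submodule.span k[X] {a'} : Submodule k[X] Y.B) ≤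
      Module.finrank k (D ⊔ Submodule.span k[X] {a} : Submodule k[X] Y.B)) :
    (Y.withSub (D ⊔ Submodule.span k[X] {a'})).ExtLE
      (Y.withSub (D ⊔ Submodule.span k[X] {a})) := by
  have hmap := map_sup_span_singleton hD a
  have hmap' := map_sup_span_singleton hD a'
  rw [ha] at hmap
  rw [ha'] at hmap'
  have hker := sup_span_singleton_inf_ker hD ha
  refine extLE_withSub hπ (hmap'.trans hmap.symm) ?_ (hmap.trans_le le_sup_right)
  have hle : D.restrictScalars k ≤
      ((D ⊔ Submodule.span k[X] {a'}) ⊓ LinearMap.ker π).restrictScalars k :=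
    fun _ hx => ⟨Submodule.mem_sup_left hx, hD hx⟩
  have hrank := finrank_map_add_finrank_inf_ker (k := k) π (D ⊔ Submodule.span k[X] {a})
  have hrank' := finrank_map_add_finrank_inf_ker (k := k) π (D ⊔ Submodule.span k[X] {a'})
  rw [hmap, hker] at hrank
  rw [hmap'] at hrank'
  rw [hker]
  refine (Submodule.restrictScalars_injective k k[X] Y.B
    (Submodule.eq_of_le_of_finrank_le hle ?_)).symm
  change Module.finrank k ((D ⊔ Submodule.span k[X] {a'}) ⊓ LinearMap.ker π : Submodule _ _) ≤
    Module.finrank k D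
  omega

end SplitExtensions

/-! ### Embeddings with a prescribed tableau -/

section Realization

theorem pow_smul_mem_of_le {R M : Type*} [CommSemiring R] [AddCommMonoid M] [Module R M]
    {A : Submodule R M} {r : R} {x : M} {m n : ℕ} (h : m ≤ n) (hx : r ^ m • x ∈ A) :
    r ^ n • x ∈ A := by
  obtain ⟨d, rfl⟩ := Nat.exists_eq_add_of_le' h
  rw [pow_add, mul_smul]
  exact A.smul_mem _ hx

theorem span_range_le_of_sub_mem {R M : Type*} [Ring R] [AddCommGroup M] [Module R M]
    {e f : ℕ → M} {N : ℕ} (he : ∀ i, N ≤ i → e i = 0)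
    (hf : ∀ i, f i - e i ∈ Submodule.span R (e '' Set.Ioi i)) :
    Submodule.span R (Set.range e) ≤ Submodule.span R (Set.range f) := by
  suffices h : ∀ d i, N ≤ i + d → e i ∈ Submodule.span R (Set.range f) from
    Submodule.span_le.2 (Set.range_subset_iff.2 fun i => h N i (Nat.le_add_left N i))
  intro d
  induction d with
  | zero => exact fun i hi => he i hi ▸ Submodule.zero_mem _
  | succ d ih =>
    intro i hi
    have htail : Submodule.span R (e '' Set.Ioi i) ≤ Submodule.span R (Set.range f) := by
      rw [Submodule.span_le, Set.image_subset_iff]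
      intro i' hi'
      rw [Set.mem_Ioi] at hi'
      exact ih i' (by omega)
    have hmem : f i ∈ Submodule.span R (Set.range f) := Submodule.subset_span ⟨i, rfl⟩
    exact (Submodule.sub_mem_iff_right _ hmem).1 (htail (hf i))

variable {k : Type u} [Field k]

theorem X_pow_smul_span_le {M : Type*} [AddCommGroup M] [Module k M] [Module k[X] M]
    [IsScalarTower k k[X] M] {a : ℕ → M} {D : Submodule k M} {e : ℕ}
    (ha : ∀ l s, e ≤ l → (X ^ l : k[X]) • a s ∈ D) :
    ((X ^ e : k[X]) • Submodule.span k[X] (Set.range a)).restrictScalars k ≤ D := by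
  rintro _ ⟨x, hx, rfl⟩
  suffices h : ∀ l, e ≤ l → (X ^ l : k[X]) • x ∈ D from h e le_rfl
  induction hx using Submodule.span_induction with
  | mem x hx =>
    obtain ⟨s, rfl⟩ := hx
    exact fun l hl => ha l s hl
  | zero =>
    intro l _
    rw [smul_zero]
    exact D.zero_mem
  | add x y _ _ hx hy =>
    intro l hl
    rw [smul_add]
    exact D.add_mem (hx l hl) (hy l hl)
  | smul p x _ hx =>
    intro l hl
    induction p using Polynomial.induction_on' with
    | add p q hp hq =>
      rw [add_smul, smul_add]
      exact D.add_mem hp hq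
    | monomial n c =>
      rw [← mul_smul, ← C_mul_X_pow_eq_monomial, ← smul_eq_C_mul, mul_smul_comm, ← pow_add,
        smul_assoc]
      exact D.smul_mem c (hx (l + n) (by omega))

variable {r : ℕ} {β γ : YoungDiagram}

/-- The ambient module `N_β` with the zero submodule. -/
noncomputable def ambient (k : Type u) [Field k] (β : YoungDiagram) : Embedding k where
  B := NilpModule k β
  nilpotent := ⟨β.colLen 0, fun b => funext fun j =>
    X_pow_smul_cyclic (β.colLen_anti 0 j (Nat.zero_le _)) (b j)⟩
  A := ⊥

/-- The embedding of a submodule of `N_β`. -/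
noncomputable def nilpEmbedding (A : Submodule k[X] (NilpModule k β)) : Embedding k :=
  (ambient k β).withSub A

/-- The generator of the `j`-th summand of `N_β`; it is zero if there is no such summand. -/
noncomputable def colGen (k : Type u) [Field k] (β : YoungDiagram) (j : ℕ) : NilpModule k β :=
  if h : j < β.rowLen 0 then Pi.single ⟨j, h⟩ 1 else 0

theorem X_pow_smul_colGen (j : ℕ) : (X ^ β.colLen j : k[X]) • colGen k β j = 0 := by
  unfold colGen
  split_ifs with h
  · rw [← Pi.single_smul]
    exact Pi.single_eq_zero_iff.2 (X_pow_smul_cyclic le_rfl _)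
  · exact smul_zero _

theorem span_range_colGen : Submodule.span k[X] (Set.range (colGen k β)) = ⊤ := by
  refine eq_top_iff.2 ((span_range_single_one fun j : Fin (β.rowLen 0) =>
    Ideal.span {(X ^ β.colLen j : k[X])}).ge.trans (Submodule.span_mono ?_))
  rintro _ ⟨j, rfl⟩
  exact ⟨j, dif_pos j.2⟩

/-- The generator of the summand of `N_β` given by the column of the box in row `i` of the rook
strip `β ∖ γ`; it is zero if there is no such box. -/
noncomputable def rowGen (k : Type u) [Field k] (β γ : YoungDiagram) (i : ℕ) : NilpModule k β :=
  if i ∈ stripRows β γ then colGen k β (γ.rowLen i) else 0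

theorem rowGen_colLen (hR : IsRookStrip β γ) {j : ℕ} (h : γ.colLen j < β.colLen j) :
    rowGen k β γ (γ.colLen j) = colGen k β j := by
  rw [rowGen, if_pos (colLen_mem_stripRows h), hR.rowLen_colLen h]

theorem X_pow_smul_rowGen (hR : IsRookStrip β γ) {i n : ℕ} (h : i < n) :
    (X ^ n : k[X]) • rowGen k β γ i = 0 := by
  unfold rowGen
  split_ifs with hi
  · rw [← Submodule.mem_bot (R := k[X])]
    refine pow_smul_mem_of_le (Nat.succ_le_of_lt h) ?_
    rw [Nat.succ_eq_add_one, ← hR.outer_colLen_rowLen hi, X_pow_smul_colGen]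
    exact Submodule.zero_mem _
  · exact smul_zero _

/-- The submodule generated by the elements `X ^ i • rowGen k β γ i'` with `i' > i`. -/
noncomputable def tail (k : Type u) [Field k] (β γ : YoungDiagram) (i : ℕ) :
    Submodule k[X] (NilpModule k β) :=
  (X ^ i : k[X]) • Submodule.span k[X] (rowGen k β γ '' Set.Ioi i)

theorem X_pow_smul_rowGen_mem_tail {i i' n : ℕ} (h : i < i') (hn : i ≤ n) :
    (X ^ n : k[X]) • rowGen k β γ i' ∈ tail k β γ i :=
  pow_smul_mem_of_le hn
    (Submodule.smul_mem_pointwise_smul _ _ _ (Submodule.subset_span ⟨i', h, rfl⟩))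

theorem exists_X_pow_smul_mem {A : Submodule k[X] (NilpModule k β)} {i : ℕ} {w : NilpModule k β}
    (hwA : w ∈ A) (hw : w - (X ^ i : k[X]) • rowGen k β γ i ∈ tail k β γ i) :
    ∃ f, (X ^ i : k[X]) • f ∈ A ∧
      f - rowGen k β γ i ∈ Submodule.span k[X] (rowGen k β γ '' Set.Ioi i) := by
  obtain ⟨g, hg, hgw⟩ := (Submodule.mem_smul_pointwise_iff_exists _ _ _).1 hw
  refine ⟨rowGen k β γ i + g, ?_, by rwa [add_sub_cancel_left]⟩
  rwa [smul_add, hgw, add_sub_cancel]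

theorem exists_deformed_rowGen {A : Submodule k[X] (NilpModule k β)} {P : ℕ → Prop}
    (hw : ∀ i, P i → ∃ w ∈ A, w - (X ^ i : k[X]) • rowGen k β γ i ∈ tail k β γ i) :
    ∃ f : ℕ → NilpModule k β, (∀ i, P i → (X ^ i : k[X]) • f i ∈ A) ∧
      (∀ i, ¬P i → f i = rowGen k β γ i) ∧
      ∀ i, f i - rowGen k β γ i ∈ Submodule.span k[X] (rowGen k β γ '' Set.Ioi i) := by
  classical
  choose! w hwA hwt using hw
  choose! f hfA hf using fun i (hi : P i) => exists_X_pow_smul_mem (hwA i hi) (hwt i hi)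
  refine ⟨fun i => if P i then f i else rowGen k β γ i, fun i hi => ?_, fun i hi => if_neg hi,
    fun i => ?_⟩
  · simp only [if_pos hi]
    exact hfA i hi
  · dsimp only
    split_ifs with hi
    · exact hf i hi
    · exact sub_self (rowGen k β γ i) ▸ Submodule.zero_mem _

/-- The generators of `N_β` obtained from the standard ones by replacing `rowGen k β γ i` by `f i`
for all boxes of the strip. -/
noncomputable def deformedGen (γ : YoungDiagram) (f : ℕ → NilpModule k β) (j : ℕ) :
    NilpModule k β :=
  if γ.colLen j < β.colLen j then f (γ.colLen j) else colGen k β j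

theorem span_range_deformedGen (hR : IsRookStrip β γ) {f : ℕ → NilpModule k β}
    (hf₀ : ∀ i ∉ stripRows β γ, f i = 0)
    (hf : ∀ i, f i - rowGen k β γ i ∈ Submodule.span k[X] (rowGen k β γ '' Set.Ioi i)) :
    Submodule.span k[X] (Set.range (deformedGen γ f)) = ⊤ := by
  obtain ⟨N, hN⟩ := Finset.exists_nat_subset_range (stripRows β γ)
  have hrow : Submodule.span k[X] (Set.range (rowGen k β γ)) ≤
      Submodule.span k[X] (Set.range f) :=
    span_range_le_of_sub_mem (N := N) (fun i hi => if_neg fun hmem =>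
      (Finset.mem_range.1 (hN hmem)).not_ge hi) hf
  have hgen : Submodule.span k[X] (Set.range f) ≤
      Submodule.span k[X] (Set.range (deformedGen γ f)) := by
    refine Submodule.span_le.2 (Set.range_subset_iff.2 fun i => ?_)
    by_cases hi : i ∈ stripRows β γ
    · have hcol := hR.colLen_rowLen hi
      refine Submodule.subset_span ⟨γ.rowLen i, ?_⟩
      rw [deformedGen, hcol, if_pos (by rw [hR.outer_colLen_rowLen hi]; exact Nat.lt_succ_self i)]
    · exact hf₀ i hi ▸ Submodule.zero_mem _
  rw [eq_top_iff, ← span_range_colGen, Submodule.span_le]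
  rintro _ ⟨j, rfl⟩
  by_cases h : γ.colLen j < β.colLen j
  · exact hgen (hrow (Submodule.subset_span ⟨γ.colLen j, rowGen_colLen hR h⟩))
  · exact Submodule.subset_span ⟨j, if_neg h⟩

theorem X_pow_smul_deformedGen_mem (hR : IsRookStrip β γ) (Γ : LRTableaux r β γ) {e : ℕ}
    {A : Submodule k[X] (NilpModule k β)} {f : ℕ → NilpModule k β}
    (hfA : ∀ i, e < rowWord Γ i → (X ^ i : k[X]) • f i ∈ A)
    (hf : ∀ i, ¬e < rowWord Γ i → f i = rowGen k β γ i) (j : ℕ) :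
    (X ^ (level Γ e).colLen j : k[X]) • deformedGen γ f j ∈ A := by
  have hcolGen : (X ^ β.colLen j : k[X]) • colGen k β j ∈ A :=
    X_pow_smul_colGen (k := k) (β := β) j ▸ A.zero_mem
  rw [hR.colLen_level, deformedGen]
  by_cases hj : γ.colLen j < β.colLen j
  · by_cases he : e < rowWord Γ (γ.colLen j)
    · rw [if_pos ⟨hj, he⟩, if_pos hj]
      exact hfA _ he
    · rwa [if_neg fun h => he h.2, if_pos hj, hf _ he, rowGen_colLen hR hj]
  · rwa [if_neg fun h => hj h.1, if_neg hj]

theorem finrank_quotient_nilpModule_add (A : Submodule k[X] (NilpModule k β)) :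
    Module.finrank k (NilpModule k β ⧸ A) + Module.finrank k A = β.card := by
  rw [← finrank_nilpModule (k := k) β]
  exact (A.restrictScalars k).finrank_quotient_add_finrank

theorem nonempty_quotient_equiv_level (hR : IsRookStrip β γ) (Γ : LRTableaux r β γ) {e : ℕ}
    {A : Submodule k[X] (NilpModule k β)}
    (hw : ∀ i, e < rowWord Γ i →
      ∃ w ∈ A, w - (X ^ i : k[X]) • rowGen k β γ i ∈ tail k β γ i)
    (hdim : Module.finrank k A ≤ ((stripRows β γ).filter fun i => e < rowWord Γ i).card) :
    Nonempty ((NilpModule k β ⧸ A) ≃ₗ[k[X]] NilpModule k (level Γ e)) := by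
  obtain ⟨f, hfA, hf, hfspan⟩ := exists_deformed_rowGen hw
  have hf₀ : ∀ i ∉ stripRows β γ, f i = 0 := fun i hi => by
    rw [hf i (by rw [(hR.isRowWord_rowWord Γ).eq_zero hi]; exact Nat.not_lt_zero e), rowGen,
      if_neg hi]
  have : FiniteDimensional k (NilpModule k β ⧸ A) :=
    FiniteDimensional.of_surjective (A.mkQ.restrictScalars k) A.mkQ_surjective
  refine nonempty_equiv_nilpModule (level Γ e) (A.mkQ ∘ deformedGen γ f) (fun j => ?_) ?_ ?_
  · exact (Submodule.Quotient.mk_eq_zero A).2 (X_pow_smul_deformedGen_mem hR Γ hfA hf j)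
  · rw [Set.range_comp, ← Submodule.map_span, span_range_deformedGen hR hf₀ hfspan,
      Submodule.map_top, Submodule.range_mkQ]
  · have hcard := hR.card_level_add Γ e
    have hrank := finrank_quotient_nilpModule_add A
    omega

/-- Elements `w i` witnessing that the embedding of the submodule of `N_β` generated by the `a s`
has the tableau with row word `W`: for each `e`, the `w i` with `e < W i` form a basis of
`X ^ e • A` over `k` with the leading terms `X ^ i • rowGen k β γ i`. -/
structure IsAdapted (β γ : YoungDiagram) (W : ℕ → ℕ) (a w : ℕ → NilpModule k β) : Prop where
  mem (i : ℕ) (hi : W i ≠ 0) : w i ∈ (X ^ (W i - 1) : k[X]) • Submodule.span k[X] (Set.range a)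
  sub_mem_tail (i : ℕ) (hi : W i ≠ 0) : w i - (X ^ i : k[X]) • rowGen k β γ i ∈ tail k β γ i
  smul_mem (l s : ℕ) : (X ^ l : k[X]) • a s ∈ Submodule.span k (w '' {i | l < W i})

namespace IsAdapted

variable {a w : ℕ → NilpModule k β} {Γ : LRTableaux r β γ}

theorem mem_X_pow_smul {W : ℕ → ℕ} (h : IsAdapted β γ W a w) {e i : ℕ} (he : e < W i) :
    w i ∈ (X ^ e : k[X]) • Submodule.span k[X] (Set.range a) := by
  have hle : (X ^ (W i - 1) : k[X]) • Submodule.span k[X] (Set.range a) ≤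
      (X ^ e : k[X]) • Submodule.span k[X] (Set.range a) := by
    rw [← Nat.add_sub_of_le (Nat.le_sub_one_of_lt he), pow_add, mul_smul]
    rintro _ ⟨_, ⟨x, hx, rfl⟩, rfl⟩
    exact Submodule.smul_mem_pointwise_smul _ _ _ (Submodule.smul_mem _ _ hx)
  exact hle (h.mem i (Nat.ne_zero_of_lt he))

theorem finrank_le {W : ℕ → ℕ} (hW : IsRowWord β γ W) (h : IsAdapted β γ W a w) (e : ℕ) :
    Module.finrank k ((X ^ e : k[X]) • Submodule.span k[X] (Set.range a) :
      Submodule k[X] (NilpModule k β)) ≤ ((stripRows β γ).filter fun i => e < W i).card := by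
  classical
  let F := (stripRows β γ).filter fun i => e < W i
  have hle : ((X ^ e : k[X]) • Submodule.span k[X] (Set.range a)).restrictScalars k ≤
      Submodule.span k (F.image w : Set (NilpModule k β)) := by
    refine X_pow_smul_span_le fun l s hl => Submodule.span_mono ?_ (h.smul_mem l s)
    rw [Finset.coe_image]
    refine Set.image_mono fun i (hi : l < W i) => Finset.mem_filter.2 ⟨?_, hl.trans_lt hi⟩
    exact (hW.ne_zero_iff i).1 (Nat.ne_zero_of_lt hi)
  exact (Submodule.finrank_mono hle).trans
    ((finrank_span_finset_le_card _).trans Finset.card_image_le)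

theorem hasTableau (hR : IsRookStrip β γ) (h : IsAdapted β γ (rowWord Γ) a w) :
    HasTableau (nilpEmbedding (Submodule.span k[X] (Set.range a))) Γ := fun e =>
  nonempty_quotient_equiv_level hR Γ
    (fun i hi => ⟨w i, h.mem_X_pow_smul hi,
      h.sub_mem_tail i (Nat.ne_zero_of_lt hi)⟩)
    (h.finrank_le (hR.isRowWord_rowWord Γ) e)

theorem inCategory (hR : IsRookStrip β γ) (hw : β.card = γ.card + r)
    (h : IsAdapted β γ (rowWord Γ) a w) :
    InCategory r β γ (nilpEmbedding (Submodule.span k[X] (Set.range a))) := by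
  obtain ⟨φ⟩ : Nonempty
      ((NilpModule k β ⧸ Submodule.span k[X] (Set.range a)) ≃ₗ[k[X]] NilpModule k γ) := by
    have h₀ := h.hasTableau hR 0
    rwa [pow_zero, one_smul, hR.level_zero] at h₀
  have hfin : FiniteDimensional k (Submodule.span k[X] (Set.range a)) :=
    FiniteDimensional.of_injective (Submodule.subtype _ |>.restrictScalars k)
      (Submodule.injective_subtype _)
  obtain ⟨n, hn⟩ := (ambient k β).nilpotent
  obtain ⟨α, ⟨ψ⟩⟩ := exists_equiv_nilpModule (k := k) (Submodule.span k[X] (Set.range a))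
    ⟨n, fun b => Subtype.ext (hn b.1)⟩
  refine ⟨⟨LinearEquiv.refl _ _⟩, ⟨φ⟩, α, ?_, ⟨ψ⟩⟩
  have hquot := (φ.restrictScalars k).finrank_eq
  have hsub := (ψ.restrictScalars k).finrank_eq
  have hrank := finrank_quotient_nilpModule_add (Submodule.span k[X] (Set.range a))
  rw [finrank_nilpModule] at hquot hsub
  omega

end IsAdapted

end Realization

section Chains

/-! ### Generators from chains -/

variable {k : Type u} [Field k] {β γ : YoungDiagram} {W : ℕ → ℕ}

/-- The generator belonging to the chain of letters of `W` with index `q`. -/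
noncomputable def chainGen (k : Type u) [Field k] (β γ : YoungDiagram) (W : ℕ → ℕ) (q : ℕ) :
    NilpModule k β :=
  ∑ i ∈ (stripRows β γ).filter fun i => colIndex W i = q,
    (X ^ (i + 1 - W i) : k[X]) • rowGen k β γ i

theorem X_pow_smul_chainGen (hR : IsRookStrip β γ) (hW : IsLattice W) (l q : ℕ) :
    (X ^ l : k[X]) • chainGen k β γ W q =
      ∑ i ∈ (stripRows β γ).filter fun i => colIndex W i = q ∧ l < W i,
        (X ^ (i + 1 + l - W i) : k[X]) • rowGen k β γ i := by
  rw [chainGen, Finset.smul_sum, ← Finset.filter_filter, Finset.sum_filter (fun i => l < W i)]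
  refine Finset.sum_congr rfl fun i _ => ?_
  have hle := hW.le_succ i
  rw [← mul_smul, ← pow_add]
  split_ifs with h
  · congr 2
    omega
  · exact X_pow_smul_rowGen hR (by omega)

theorem X_pow_smul_chainGen_mem (hR : IsRookStrip β γ) (hW : IsLattice W) {l q : ℕ}
    {D : Submodule k[X] (NilpModule k β)}
    (h : ∀ i, colIndex W i = q → l < W i →
      (X ^ (i + 1 + l - W i) : k[X]) • rowGen k β γ i ∈ D) :
    (X ^ l : k[X]) • chainGen k β γ W q ∈ D := by
  rw [X_pow_smul_chainGen hR hW]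
  refine Submodule.sum_mem _ fun i hi => ?_
  obtain ⟨-, hq, hl⟩ := Finset.mem_filter.1 hi
  exact h i hq hl

theorem X_pow_smul_chainGen_eq_zero (hR : IsRookStrip β γ) (hW : IsLattice W) {l q : ℕ}
    (h : ∀ i, W i = l + 1 → colIndex W i ≠ q) : (X ^ l : k[X]) • chainGen k β γ W q = 0 :=
  (Submodule.mem_bot k[X]).1 <| X_pow_smul_chainGen_mem hR hW fun _ hq hl =>
    absurd (hW.le_of_forall_colIndex_ne h hq) hl.not_ge

theorem X_pow_smul_chainGen_sub_mem (hR : IsRookStrip β γ) (hW : IsRowWord β γ W) {i₀ : ℕ}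
    (hi₀ : W i₀ ≠ 0) {D : Submodule k[X] (NilpModule k β)}
    (h : ∀ i, colIndex W i = colIndex W i₀ → W i₀ < W i →
      (X ^ (i + W i₀ - W i) : k[X]) • rowGen k β γ i ∈ D) :
    (X ^ (W i₀ - 1) : k[X]) • chainGen k β γ W (colIndex W i₀) -
      (X ^ i₀ : k[X]) • rowGen k β γ i₀ ∈ D := by
  have hmem : i₀ ∈ (stripRows β γ).filter fun i =>
      colIndex W i = colIndex W i₀ ∧ W i₀ - 1 < W i :=
    Finset.mem_filter.2 ⟨(hW.ne_zero_iff i₀).1 hi₀, rfl, by omega⟩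
  rw [X_pow_smul_chainGen hR hW.lattice, ← Finset.add_sum_erase _ _ hmem,
    show i₀ + 1 + (W i₀ - 1) - W i₀ = i₀ by omega, add_sub_cancel_left]
  refine Submodule.sum_mem _ fun i hi => ?_
  obtain ⟨hne, hi⟩ := Finset.mem_erase.1 hi
  obtain ⟨-, hq, hl⟩ := Finset.mem_filter.1 hi
  have hWne : W i ≠ W i₀ := fun hWi => hne (eq_of_colIndex_eq hWi hq)
  rw [show i + 1 + (W i₀ - 1) - W i = i + W i₀ - W i by omega]
  exact h i hq (by omega)

theorem X_pow_smul_chainGen_sub_mem_tail (hR : IsRookStrip β γ) (hW : IsRowWord β γ W) {i : ℕ}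
    (hi : W i ≠ 0) :
    (X ^ (W i - 1) : k[X]) • chainGen k β γ W (colIndex W i) - (X ^ i : k[X]) • rowGen k β γ i ∈
      tail k β γ i := by
  refine X_pow_smul_chainGen_sub_mem hR hW hi fun i' hq hlt => ?_
  have hle := hW.lattice.add_sub_le (Nat.one_le_iff_ne_zero.2 hi) hlt.le hq.symm
  exact X_pow_smul_rowGen_mem_tail (by omega) (by omega)

theorem isAdapted_chainGen (k : Type u) [Field k] (hR : IsRookStrip β γ)
    (hW : IsRowWord β γ W) :
    IsAdapted β γ W (chainGen k β γ W)
      fun i => (X ^ (W i - 1) : k[X]) • chainGen k β γ W (colIndex W i) where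
  mem i _ := Submodule.smul_mem_pointwise_smul _ _ _ (Submodule.subset_span ⟨_, rfl⟩)
  sub_mem_tail i hi := X_pow_smul_chainGen_sub_mem_tail hR hW hi
  smul_mem l s := by
    by_cases h : ∃ i, W i = l + 1 ∧ colIndex W i = s
    · obtain ⟨i, hi, rfl⟩ := h
      exact Submodule.subset_span ⟨i, Nat.lt_of_succ_le hi.ge, by simp only [hi]; rfl⟩
    · push Not at h
      rw [X_pow_smul_chainGen_eq_zero hR hW.lattice h]
      exact Submodule.zero_mem _

end Chains

section LoweredChains

/-! ### Chains of a lowering -/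

namespace IsLowering

variable {W : ℕ → ℕ} {p b i : ℕ} (h : IsLowering W p b)
include h

theorem le_succ : b ≤ p + 1 := lower_self W p b ▸ h.lattice_lower.le_succ p

theorem letterCount_lt_pred : letterCount W b p < letterCount W (b - 1) p := by
  have hpos := h.pos
  have hlt := h.lt
  have hlattice := h.lattice_lower (p + 1) (b - 1) (by omega)
  rw [Nat.sub_add_cancel (by omega)] at hlattice
  have hcount : letterCount W b (p + 1) = letterCount W b p := by
    rw [letterCount_succ, if_neg hlt.ne, add_zero]
  have hbefore : BeforeNext W p b (p + 1) := ⟨Nat.lt_succ_self p, hcount⟩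
  have hlow := letterCount_lower hlt.ne b (p + 1)
  have hlow' := letterCount_lower hlt.ne (b - 1) (p + 1)
  have hsucc := letterCount_succ W (b - 1) p
  rw [if_neg fun h => hlt.ne h.2, if_pos ⟨hbefore, rfl⟩] at hlow
  simp only [hbefore, true_and, if_neg (show b ≠ b - 1 by omega)] at hlow'
  omega

theorem exists_pred : ∃ i < p, W i = b - 1 ∧ colIndex W i = letterCount W b p := by
  obtain ⟨i, hi, hWi, hcount⟩ := exists_of_lt_letterCount h.letterCount_lt_pred
  exact ⟨i, hi, hWi, by rw [colIndex, hWi, hcount]⟩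

theorem letterCount_lt_colIndex : letterCount W b p < colIndex W p :=
  h.letterCount_lt_pred.trans_le
    (h.lattice.letterCount_anti h.pos (Nat.le_sub_one_of_lt h.lt) p)

theorem isNext_iff : IsNext W p b i ↔ W i = b ∧ colIndex W i = letterCount W b p := by
  refine ⟨fun hi => ⟨hi.2, hi.colIndex_eq⟩, fun ⟨hWi, hi⟩ => ?_⟩
  rw [colIndex, hWi] at hi
  refine ⟨⟨lt_of_le_of_ne ?_ ?_, hi⟩, hWi⟩
  · by_contra! hip
    exact (letterCount_lt_letterCount hWi hip).ne hi
  · rintro rfl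
    exact h.lt.ne hWi

theorem exists_isNext_add_le (hi : colIndex W i = colIndex W p) (hlt : W p < W i) :
    ∃ j, IsNext W p b j ∧ j + (W i - W p) ≤ i := by
  have hpb := h.lt
  obtain ⟨i', hi', hWi', hci'⟩ := h.lattice.exists_above (l := W p + 1) (by omega) hlt
  have hpi' : p < i' := by
    have := h.lattice.add_sub_le (i' := i') h.pos (by omega) (hci'.trans hi).symm
    omega
  have hcount : letterCount W b p < letterCount W b i' := by
    by_contra! hle
    have heq := le_antisymm hle (letterCount_mono W b hpi'.le)
    have hgap := h.gap i' ⟨hpi', heq⟩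
    have hWb : W i' = b := by omega
    have hcol : colIndex W i' = letterCount W b p := by rw [colIndex, hWb, heq]
    exact h.letterCount_lt_colIndex.ne (hcol.symm.trans (hci'.trans hi))
  obtain ⟨j, hj, hWj, hcj⟩ := exists_of_lt_letterCount hcount
  exact ⟨j, h.isNext_iff.2 ⟨hWj, by rw [colIndex, hWj, hcj]⟩, by omega⟩

end IsLowering

/-! ### Generators of the deformed embedding -/

variable {k : Type u} [Field k] {β γ : YoungDiagram} {W : ℕ → ℕ} {p b i l s : ℕ}

/-- The chain generators of `W`, where the generator of the chain that the position `p` joins under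
the lowering is modified. -/
noncomputable def lowerGen (k : Type u) [Field k] (β γ : YoungDiagram) (W : ℕ → ℕ) (p b : ℕ) :
    ℕ → NilpModule k β :=
  Function.update (chainGen k β γ W) (letterCount W b p)
    (chainGen k β γ W (letterCount W b p) + (X ^ (p + 1 - b) : k[X]) • rowGen k β γ p)

theorem lowerGen_self :
    lowerGen k β γ W p b (letterCount W b p) =
      chainGen k β γ W (letterCount W b p) + (X ^ (p + 1 - b) : k[X]) • rowGen k β γ p :=
  Function.update_self ..

theorem lowerGen_of_ne (h : s ≠ letterCount W b p) :
    lowerGen k β γ W p b s = chainGen k β γ W s :=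
  Function.update_of_ne h ..

open Classical in
/-- The elements showing that `lowerGen k β γ W p b` generates an embedding with the tableau of the
lowered word; see `isAdapted_lowerGen`. -/
noncomputable def lowerWitness (k : Type u) [Field k] (β γ : YoungDiagram) (W : ℕ → ℕ)
    (p b i : ℕ) : NilpModule k β :=
  if i = p then (X ^ (b - 1) : k[X]) • lowerGen k β γ W p b (letterCount W b p)
  else if IsNext W p b i then
    (X ^ (b - 1) : k[X]) • lowerGen k β γ W p b (letterCount W b p) -
      (X ^ (W p - 1) : k[X]) • lowerGen k β γ W p b (colIndex W p)
  else (X ^ (W i - 1) : k[X]) • lowerGen k β γ W p b (colIndex W i)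

theorem lowerWitness_self :
    lowerWitness k β γ W p b p =
      (X ^ (b - 1) : k[X]) • lowerGen k β γ W p b (letterCount W b p) :=
  if_pos rfl

theorem lowerWitness_next (hi : IsNext W p b i) :
    lowerWitness k β γ W p b i = lowerWitness k β γ W p b p -
      (X ^ (W p - 1) : k[X]) • lowerGen k β γ W p b (colIndex W p) := by
  rw [lowerWitness, if_neg hi.lt.ne', if_pos hi, lowerWitness_self]

theorem lowerWitness_of_ne (hip : i ≠ p) (hi : ¬IsNext W p b i) :
    lowerWitness k β γ W p b i =
      (X ^ (W i - 1) : k[X]) • lowerGen k β γ W p b (colIndex W i) := by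
  rw [lowerWitness, if_neg hip, if_neg hi]

theorem lowerWitness_mem_span (hi : l < lower W p b i) :
    lowerWitness k β γ W p b i ∈
      Submodule.span k (lowerWitness k β γ W p b '' {i | l < lower W p b i}) :=
  Submodule.subset_span ⟨i, hi, rfl⟩

namespace IsLowering

variable (hL : IsLowering W p b)
include hL

theorem X_pow_smul_lowerGen (l : ℕ) :
    (X ^ l : k[X]) • lowerGen k β γ W p b (letterCount W b p) =
      (X ^ l : k[X]) • chainGen k β γ W (letterCount W b p) +
        (X ^ (p + 1 + l - b) : k[X]) • rowGen k β γ p := by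
  have hle := hL.le_succ
  rw [lowerGen_self, smul_add, ← mul_smul, ← pow_add]
  congr 3
  omega

theorem lowerWitness_self_eq :
    lowerWitness k β γ W p b p =
      (X ^ (b - 1) : k[X]) • chainGen k β γ W (letterCount W b p) +
        (X ^ p : k[X]) • rowGen k β γ p := by
  have hlt := hL.lt
  rw [lowerWitness_self, hL.X_pow_smul_lowerGen, show p + 1 + (b - 1) - b = p by omega]

theorem lowerWitness_mem (i : ℕ) :
    lowerWitness k β γ W p b i ∈ (X ^ (lower W p b i - 1) : k[X]) •
      Submodule.span k[X] (Set.range (lowerGen k β γ W p b)) := by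
  have hpos := hL.pos
  have hlt := hL.lt
  have hgen (s : ℕ) : lowerGen k β γ W p b s ∈
      Submodule.span k[X] (Set.range (lowerGen k β γ W p b)) := Submodule.subset_span ⟨s, rfl⟩
  rcases eq_or_ne i p with rfl | hip
  · rw [lower_self, lowerWitness_self]
    exact Submodule.smul_mem_pointwise_smul _ _ _ (hgen _)
  by_cases hi : IsNext W p b i
  · rw [lower_next hi, lowerWitness_next hi, lowerWitness_self,
      show b - 1 = W p - 1 + (b - W p) by omega, pow_add, mul_smul]
    exact Submodule.sub_mem _
      (Submodule.smul_mem_pointwise_smul _ _ _ (Submodule.smul_mem _ _ (hgen _)))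
      (Submodule.smul_mem_pointwise_smul _ _ _ (hgen _))
  · rw [lower_of_ne hip hi, lowerWitness_of_ne hip hi]
    exact Submodule.smul_mem_pointwise_smul _ _ _ (hgen _)

theorem lowerWitness_self_sub_mem_tail (hR : IsRookStrip β γ) :
    lowerWitness k β γ W p b p - (X ^ p : k[X]) • rowGen k β γ p ∈ tail k β γ p := by
  have hlt := hL.lt
  rw [hL.lowerWitness_self_eq, add_sub_cancel_right]
  refine X_pow_smul_chainGen_mem hR hL.lattice fun i hq hi => ?_
  obtain ⟨j, hji, hWj, hcj⟩ := hL.lattice.exists_above (l := b) (by omega)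
    (show b ≤ W i by omega)
  have hpj := (hL.isNext_iff.2 ⟨hWj, hcj.trans hq⟩).lt
  exact X_pow_smul_rowGen_mem_tail (by omega) (by omega)

theorem lowerWitness_next_sub_mem_tail (hR : IsRookStrip β γ) (hW : IsRowWord β γ W)
    (hi : IsNext W p b i) :
    lowerWitness k β γ W p b i - (X ^ i : k[X]) • rowGen k β γ i ∈ tail k β γ i := by
  have hpos := hL.pos
  have hlt := hL.lt
  have hnext : (X ^ (b - 1) : k[X]) • chainGen k β γ W (letterCount W b p) -
      (X ^ i : k[X]) • rowGen k β γ i ∈ tail k β γ i := by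
    rw [← hi.colIndex_eq, ← hi.2]
    exact X_pow_smul_chainGen_sub_mem_tail hR hW (by rw [hi.2]; omega)
  have hself : (X ^ (W p - 1) : k[X]) • chainGen k β γ W (colIndex W p) -
      (X ^ p : k[X]) • rowGen k β γ p ∈ tail k β γ i := by
    refine X_pow_smul_chainGen_sub_mem hR hW (by omega) fun i' hc hi' => ?_
    obtain ⟨j, hj, hji⟩ := hL.exists_isNext_add_le hc hi'
    rw [hj.unique hi] at hji
    exact X_pow_smul_rowGen_mem_tail (by omega) (by omega)
  rw [lowerWitness_next hi, hL.lowerWitness_self_eq,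
    lowerGen_of_ne hL.letterCount_lt_colIndex.ne']
  convert Submodule.sub_mem _ hnext hself using 1
  abel

theorem lowerWitness_sub_mem_tail_of_ne (hR : IsRookStrip β γ) (hW : IsRowWord β γ W)
    (hip : i ≠ p) (hi : ¬IsNext W p b i) (hne : W i ≠ 0) :
    lowerWitness k β γ W p b i - (X ^ i : k[X]) • rowGen k β γ i ∈ tail k β γ i := by
  have htail := X_pow_smul_chainGen_sub_mem_tail (k := k) hR hW hne
  rw [lowerWitness_of_ne hip hi]
  by_cases hc : colIndex W i = letterCount W b p
  · rw [hc] at htail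
    rw [hc, hL.X_pow_smul_lowerGen, add_sub_right_comm]
    refine Submodule.add_mem _ htail ?_
    have hWb : W i ≠ b := fun h => hi (hL.isNext_iff.2 ⟨h, hc⟩)
    rcases lt_or_gt_of_ne hWb with hlt | hgt
    · obtain ⟨i', hi', hWi', hci'⟩ := hL.exists_pred
      have hle := hW.lattice.add_sub_le (Nat.one_le_iff_ne_zero.2 hne)
        (show W i ≤ W i' by omega) (hc.trans hci'.symm)
      exact X_pow_smul_rowGen_mem_tail (by omega) (by omega)
    · rw [X_pow_smul_rowGen hR (by omega)]
      exact Submodule.zero_mem _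
  · rwa [lowerGen_of_ne hc]

theorem X_pow_smul_chainGen_of_forall_not_isNext (hR : IsRookStrip β γ) (hW : IsRowWord β γ W)
    (hnext : ∀ j, ¬IsNext W p b j) :
    (X ^ (W p - 1) : k[X]) • chainGen k β γ W (colIndex W p) = lowerWitness k β γ W p b p := by
  have hpos := hL.pos
  have hlt := hL.lt
  rw [hL.lowerWitness_self_eq, X_pow_smul_chainGen_eq_zero hR hW.lattice fun i hWi hc =>
    hnext i (hL.isNext_iff.2 ⟨by omega, hc⟩), zero_add, ← sub_eq_zero, ← Submodule.mem_bot k[X]]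
  refine X_pow_smul_chainGen_sub_mem hR hW (by omega) fun i hc hi => ?_
  obtain ⟨j, hj, -⟩ := hL.exists_isNext_add_le hc hi
  exact absurd hj (hnext j)

theorem X_pow_smul_lowerGen_self_mem (hR : IsRookStrip β γ) (hW : IsRowWord β γ W) :
    (X ^ (W p - 1) : k[X]) • lowerGen k β γ W p b (colIndex W p) ∈
      Submodule.span k (lowerWitness k β γ W p b '' {i | W p - 1 < lower W p b i}) := by
  have hpos := hL.pos
  have hlt := hL.lt
  have hself := lowerWitness_mem_span (k := k) (β := β) (γ := γ) (W := W) (b := b) (i := p)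
    (l := W p - 1) (by rw [lower_self]; omega)
  by_cases hnext : ∃ j, IsNext W p b j
  · obtain ⟨j, hj⟩ := hnext
    have hmem := Submodule.sub_mem _ hself
      (lowerWitness_mem_span (i := j) (by rw [lower_next hj]; omega))
    rwa [lowerWitness_next hj, sub_sub_cancel] at hmem
  · rwa [lowerGen_of_ne hL.letterCount_lt_colIndex.ne',
      hL.X_pow_smul_chainGen_of_forall_not_isNext hR hW (not_exists.1 hnext)]

theorem X_pow_smul_lowerGen_mem_of_eq (hR : IsRookStrip β γ) (hW : IsRowWord β γ W)
    (hi : W i = l + 1) :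
    (X ^ l : k[X]) • lowerGen k β γ W p b (colIndex W i) ∈
      Submodule.span k (lowerWitness k β γ W p b '' {i | l < lower W p b i}) := by
  obtain rfl : l = W i - 1 := by omega
  rcases eq_or_ne i p with rfl | hip
  · exact hL.X_pow_smul_lowerGen_self_mem hR hW
  by_cases hnext : IsNext W p b i
  · rw [hnext.colIndex_eq, hnext.2, ← lowerWitness_self]
    exact lowerWitness_mem_span (by rw [lower_self, ← hnext.2]; omega)
  · rw [← lowerWitness_of_ne hip hnext]
    exact lowerWitness_mem_span (by rw [lower_of_ne hip hnext]; omega)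

theorem X_pow_smul_lowerGen_mem_of_forall_ne (hR : IsRookStrip β γ) (hW : IsRowWord β γ W)
    (hs : ∀ i, W i = l + 1 → colIndex W i ≠ s) :
    (X ^ l : k[X]) • lowerGen k β γ W p b s ∈
      Submodule.span k (lowerWitness k β γ W p b '' {i | l < lower W p b i}) := by
  have hlt := hL.lt
  have hzero := X_pow_smul_chainGen_eq_zero (k := k) hR hW.lattice hs
  by_cases hsq : s = letterCount W b p
  · subst hsq
    obtain ⟨i, -, hWi, hci⟩ := hL.exists_pred
    have hle : W i ≤ l := hW.lattice.le_of_forall_colIndex_ne hs hci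
    rcases (show b - 1 ≤ l by omega).eq_or_lt with rfl | hl
    · rw [← lowerWitness_self]
      exact lowerWitness_mem_span (by rw [lower_self]; omega)
    · rw [hL.X_pow_smul_lowerGen, hzero, X_pow_smul_rowGen hR (by omega), add_zero]
      exact Submodule.zero_mem _
  · rw [lowerGen_of_ne hsq, hzero]
    exact Submodule.zero_mem _

theorem isAdapted_lowerGen (k : Type u) [Field k] (hR : IsRookStrip β γ)
    (hW : IsRowWord β γ W) :
    IsAdapted β γ (lower W p b) (lowerGen k β γ W p b) (lowerWitness k β γ W p b) where
  mem i _ := hL.lowerWitness_mem i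
  sub_mem_tail i hi := by
    rw [hL.lower_ne_zero_iff] at hi
    rcases eq_or_ne i p with rfl | hip
    · exact hL.lowerWitness_self_sub_mem_tail hR
    by_cases hnext : IsNext W p b i
    · exact hL.lowerWitness_next_sub_mem_tail hR hW hnext
    · exact hL.lowerWitness_sub_mem_tail_of_ne hR hW hip hnext hi
  smul_mem l s := by
    by_cases hs : ∃ i, W i = l + 1 ∧ colIndex W i = s
    · obtain ⟨i, hi, rfl⟩ := hs
      exact hL.X_pow_smul_lowerGen_mem_of_eq hR hW hi
    · push Not at hs
      exact hL.X_pow_smul_lowerGen_mem_of_forall_ne hR hW hs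

end IsLowering

end LoweredChains

section LoweringExtensions

/-! ### Lowerings as split extensions -/

variable {k : Type u} [Field k] {r : ℕ} {β γ : YoungDiagram} {W : ℕ → ℕ} {p b i q s : ℕ}

/-- The projection of `N_β` to the summands with index in `P`. -/
noncomputable def colProj (k : Type u) [Field k] (β : YoungDiagram) (P : ℕ → Prop)
    [DecidablePred P] : NilpModule k β →ₗ[k[X]] NilpModule k β :=
  LinearMap.pi fun j => if P j then LinearMap.proj j else 0

theorem colProj_apply (P : ℕ → Prop) [DecidablePred P] (x : NilpModule k β)
    (j : Fin (β.rowLen 0)) : colProj k β P x j = if P j then x j else 0 := by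
  rw [colProj, LinearMap.pi_apply]
  split_ifs <;> rfl

theorem isIdempotentElem_colProj (P : ℕ → Prop) [DecidablePred P] :
    IsIdempotentElem (colProj k β P) := by
  refine LinearMap.ext fun x => funext fun j => ?_
  rw [Module.End.mul_apply, colProj_apply, colProj_apply]
  split_ifs <;> rfl

theorem colProj_colGen (P : ℕ → Prop) [DecidablePred P] (j : ℕ) :
    colProj k β P (colGen k β j) = if P j then colGen k β j else 0 := by
  unfold colGen
  by_cases hj : j < β.rowLen 0
  · rw [dif_pos hj]
    funext j'
    rw [colProj_apply]
    rcases eq_or_ne j' ⟨j, hj⟩ with rfl | hne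
    · split_ifs <;> rfl
    · have hzero : (Pi.single ⟨j, hj⟩ 1 : NilpModule k β) j' = 0 := Pi.single_eq_of_ne hne _
      rw [hzero, ite_self]
      split_ifs
      · exact hzero.symm
      · rfl
  · rw [dif_neg hj, map_zero, ite_self]

/-- The projection of `N_β` which splits off the columns of the chain of letters of `W` with
index `q`. -/
noncomputable def chainProj (k : Type u) [Field k] (β γ : YoungDiagram) (W : ℕ → ℕ) (q : ℕ) :
    NilpModule k β →ₗ[k[X]] NilpModule k β :=
  colProj k β fun j => colIndex W (γ.colLen j) = q

theorem chainProj_rowGen (hR : IsRookStrip β γ) (i : ℕ) :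
    chainProj k β γ W q (rowGen k β γ i) =
      if colIndex W i = q then rowGen k β γ i else 0 := by
  unfold rowGen
  split_ifs with hi hq
  · rw [chainProj, colProj_colGen, hR.colLen_rowLen hi, if_pos hq]
  · rw [chainProj, colProj_colGen, hR.colLen_rowLen hi, if_neg hq]
  · exact map_zero _
  · exact map_zero _

theorem chainProj_chainGen (hR : IsRookStrip β γ) :
    chainProj k β γ W q (chainGen k β γ W s) = if s = q then chainGen k β γ W s else 0 := by
  have hterm (i : ℕ) (hi : i ∈ (stripRows β γ).filter fun i => colIndex W i = s) :
      chainProj k β γ W q ((X ^ (i + 1 - W i) : k[X]) • rowGen k β γ i) =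
        if s = q then (X ^ (i + 1 - W i) : k[X]) • rowGen k β γ i else 0 := by
    rw [map_smul, chainProj_rowGen hR, (Finset.mem_filter.1 hi).2, smul_ite, smul_zero]
  rw [chainGen, map_sum, Finset.sum_congr rfl hterm]
  split_ifs
  · rfl
  · exact Finset.sum_const_zero

theorem IsLowering.chainProj_lowerGen (hL : IsLowering W p b) (hR : IsRookStrip β γ) :
    chainProj k β γ W (letterCount W b p) (lowerGen k β γ W p b (letterCount W b p)) =
      chainGen k β γ W (letterCount W b p) := by
  rw [lowerGen_self, map_add, map_smul, chainProj_chainGen hR, chainProj_rowGen hR, if_pos rfl,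
    if_neg hL.letterCount_lt_colIndex.ne', smul_zero, add_zero]

theorem span_range_eq_sup_span_singleton {R M ι : Type*} [Semiring R] [AddCommMonoid M]
    [Module R M] (a : ι → M) (i : ι) :
    Submodule.span R (Set.range a) =
      Submodule.span R (a '' {i}ᶜ) ⊔ Submodule.span R {a i} := by
  rw [← Submodule.span_union, ← Set.image_singleton, ← Set.image_union, Set.compl_union_self,
    Set.image_univ]

theorem span_chainGen_le_ker (hR : IsRookStrip β γ) :
    Submodule.span k[X] (chainGen k β γ W '' {q}ᶜ) ≤ LinearMap.ker (chainProj k β γ W q) := by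
  refine Submodule.span_le.2 (Set.image_subset_iff.2 fun s hs => ?_)
  exact (chainProj_chainGen hR).trans (if_neg hs)

theorem IsLowering.extLE (hL : IsLowering W p b) (hR : IsRookStrip β γ)
    (hdim : Module.finrank k (Submodule.span k[X] (Set.range (lowerGen k β γ W p b))) ≤
      Module.finrank k (Submodule.span k[X] (Set.range (chainGen k β γ W)))) :
    (nilpEmbedding (Submodule.span k[X] (Set.range (lowerGen k β γ W p b)))).ExtLE
      (nilpEmbedding (Submodule.span k[X] (Set.range (chainGen k β γ W)))) := by
  have himage : lowerGen k β γ W p b '' {letterCount W b p}ᶜ =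
      chainGen k β γ W '' {letterCount W b p}ᶜ :=
    Set.image_congr fun _ hs => lowerGen_of_ne hs
  rw [span_range_eq_sup_span_singleton _ (letterCount W b p), himage,
    span_range_eq_sup_span_singleton (chainGen k β γ W) (letterCount W b p)] at hdim ⊢
  exact extLE_sup_span_singleton (Y := ambient k β) (isIdempotentElem_colProj _)
    (span_chainGen_le_ker hR) ((chainProj_chainGen hR).trans (if_pos rfl))
    (hL.chainProj_lowerGen hR) hdim

theorem InCategory.finrank_eq {Y : Embedding k} (h : InCategory r β γ Y) :
    Module.finrank k Y.A = r := by
  obtain ⟨-, -, α, rfl, ⟨φ⟩⟩ := h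
  exact (φ.restrictScalars k).finrank_eq.trans (finrank_nilpModule α)

theorem LowerMove.exists_extLE (k : Type u) [Field k] (hR : IsRookStrip β γ)
    (hw : β.card = γ.card + r) {Δ Γ : LRTableaux r β γ} (h : LowerMove Δ Γ) :
    ∃ Y Z : Embedding k, InCategory r β γ Y ∧ InCategory r β γ Z ∧
      HasTableau Y Δ ∧ HasTableau Z Γ ∧ Y.ExtLE Z := by
  obtain ⟨p, b, hL, hΔ⟩ := h
  have hZ := isAdapted_chainGen k hR (hR.isRowWord_rowWord Γ)
  have hY := hL.isAdapted_lowerGen k hR (hR.isRowWord_rowWord Γ)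
  rw [← hΔ] at hY
  have hYcat := hY.inCategory hR hw
  have hZcat := hZ.inCategory hR hw
  exact ⟨_, _, hYcat, hZcat, hY.hasTableau hR, hZ.hasTableau hR,
    hL.extLE hR (hYcat.finrank_eq.trans hZcat.finrank_eq.symm).le⟩

theorem DomLE.extLE (k : Type u) [Field k] (hR : IsRookStrip β γ) (hw : β.card = γ.card + r)
    {Δ Γ : LRTableaux r β γ} (h : DomLE Δ Γ) : ExtLE k Δ Γ :=
  Relation.ReflTransGen.mono (fun _ _ hmove => hmove.exists_extLE k hR hw) _ _
    (h.reflTransGen_lowerMove hR hw)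

end LoweringExtensions

end LRInv

theorem mainTheorem2 (k : Type u) [Field k] (r : ℕ) (hr : 1 ≤ r) (β γ : YoungDiagram)
    (hrook : LRInv.IsRookStrip β γ) (hweight : β.card = γ.card + r)
    (Δ Γ : LRInv.LRTableaux r β γ) :
    (LRInv.BoxLE Δ Γ ↔ LRInv.ExtLE k Δ Γ) ∧
    (LRInv.ExtLE k Δ Γ ↔ LRInv.HomLE k Δ Γ) ∧
    (LRInv.HomLE k Δ Γ ↔ LRInv.DomLE Δ Γ) := by
  have ext_dom : LRInv.ExtLE k Δ Γ → LRInv.DomLE Δ Γ := fun h => h.homLE.domLE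
  have dom_ext : LRInv.DomLE Δ Γ → LRInv.ExtLE k Δ Γ := fun h => h.extLE k hrook hweight
  exact ⟨⟨fun h => dom_ext (h.domLE hrook hweight), fun h => (ext_dom h).boxLE hrook hweight⟩,
    ⟨fun h => h.homLE, fun h => dom_ext h.domLE⟩, ⟨fun h => h.domLE, fun h => (dom_ext h).homLE⟩⟩
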